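/- **Conventions.** A grid diagram of grid number $n$ is a torus $T$ with $n$ horizontal circles $\alpha$ and $n$ vertical circles $\beta$, cutting $T$ into $n$ horizontal and $n$ vertical annuli (and $n^2$ components), together with $n$ markings $X$ and $n$ markings $O$, at most one in each component, such that each horizontal and each vertical annulus contains exactly one $X$ and one $O$. It represents the link obtained by joining the two markings of every annulus. A generator $\hat x$ is a set of $n$ points of $\alpha\cap\beta$ with one point on each circle. A domain from $\hat x$ to $\hat y$ is an integral combination $D$ of components of $T\setminus(\alpha\cup\beta)$ with $\partial(\partial D|_\alpha)=\hat y-\hat x$; it is positive if all its coefficients are $\ge 0$, and $n_p(D)$ is its coefficient at $p$. The set $\widehat{\mathcal G}$ of generators is ordered by $\hat y\preceq\hat x$ iff there is a positive domain from $\hat x$ to $\hat y$ with coefficient $0$ at all markings. The set $\mathcal G^-$ of formal products $\hat x\prod_i U_i^{k_i}$ ($k_i\in\mathbb Z_{\ge0}$, one variable for each marking $O_i$) is ordered by $\hat y\prod_i U_i^{l_i}\preceq\hat x\prod_i U_i^{k_i}$ iff there is a positive domain $D$ from $\hat x$ to $\hat y$ with $n_{X_i}(D)=0$ and $n_{O_i}(D)=l_i-k_i$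 for all $i$. Let $H$ be a grid diagram representing a knot and let $X_1$ be one of its $X$ markings. Let $G$ be obtained from $H$ by the following stabilization at $X_1$ (the other types of stabilization are reduced to this one by rotating the diagram): one adds a circle $\alpha_s$ and a circle $\beta_s$ through the component of $X_1$, meeting in that component in a point $\rho$; of the four components around $\rho$ the bottom right one gets a new marking $X_0$, the top right one a new marking $O_0$, the top left one contains $X_1$, and the bottom left one is empty; the $O$ marking of $H$ in the row of $X_1$, called $O_1$, is put in the row of $X_0$, and the $O$ marking of $H$ in the column of $X_1$ is put in the column of $X_1$ in $G$; the other markings stay in place. Let $\hat f$ be the bijection from the generators of $G$ that contain $\rho$ to the generators of $H$ which forgets $\rho$. The poset $\widehat{\mathcal G}_s$ is the disjoint union of $\widehat{\mathcal G}$ and two copies $\widehat{\mathcal H}$, $\widehat{\mathcal H}'$ of the poset of generators of $H$, each with its own order, and in addition, for $\hat x\in\widehat{\mathcal G}$: * for $\hat y\in\widehat{\mathcal H}'$, $\hat y\preceq\hat x$ iff there is a positive domain in $G$ from $\hat x$ to $\hat f^{-1}(\hat y)$ with coefficient $0$ at all markings; * for $\hat y\in\widehat{\mathcal H}$, $\hat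 y\preceq\hat x$ iff there is a positive domain in $G$ from $\hat x$ to $\hat f^{-1}(\hat y)$ with coefficient $1$ at $X_0$ and $0$ at all other markings. The poset $\mathcal G_s^-$ is the disjoint union of $\mathcal G^-$ and $\mathcal H^-$, each with its own order, and in addition $$\hat y\,U_1^{n_0+n_1+k_0+k_1}\prod_{i>1}U_i^{n_i+k_i}\preceq\hat x\prod_{i\ge0}U_i^{n_i}\qquad(\hat x\in\widehat{\mathcal G},\ \hat y\in\widehat{\mathcal H})$$ iff there is a positive domain $D$ in $G$ from $\hat x$ to $\hat f^{-1}(\hat y)$ with $n_{X_0}(D)=1$, $n_{X_i}(D)=0$ for $i\neq0$, and $n_{O_i}(D)=k_i$ for all $i\ge0$. There are no further relations. A poset is graded if in every interval all maximal chains have the same cardinality. A graded poset is shellable if its maximal chains have a total order such that whenever $\mathfrak m_i<\mathfrak m_j$ there are a maximal chain $\mathfrak m_k<\mathfrak m_j$ and an element $x\in\mathfrak m_j$ with $\mathfrak m_i\cap\mathfrak m_j\subseteq\mathfrak m_k\cap\mathfrak m_j=\mathfrak m_j\setminus\{x\}$. **Theorem.** Every closed interval $[y,x]=\{z : y\preceq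 z\preceq x\}$ of the stabilization posets $\widehat{\mathcal G}_s$ and $\mathcal G_s^-$ is shellable. -/

import Mathlib

/-! ### Shellability of posets -/

/-- Maximal chains of the poset `P`. -/
abbrev MaxChain (P : Type*) [PartialOrder P] : Type _ :=
  {s : Set P // IsMaxChain (· ≤ ·) s}

/-- A poset is graded if in every (closed) interval all maximal chains have the same length. -/
def PosetGraded (P : Type*) [PartialOrder P] : Prop :=
  ∀ a b : P, ∀ s t : MaxChain (Set.Icc a b), s.1.encard = t.1.encard

/-- A graded poset is shellable if its maximal chains admit a total order `lt` such that
`mᵢ < mⱼ` implies that there are `mₖ < mⱼ` and `x ∈ mⱼ` with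
`mᵢ ∩ mⱼ ⊆ mₖ ∩ mⱼ = mⱼ \ {x}`. -/
def PosetShellable (P : Type*) [PartialOrder P] : Prop :=
  PosetGraded P ∧
    ∃ lt : MaxChain P → MaxChain P → Prop, IsStrictTotalOrder (MaxChain P) lt ∧
      ∀ mi mj : MaxChain P, lt mi mj →
        ∃ mk : MaxChain P, lt mk mj ∧ ∃ x ∈ mj.1,
          mi.1 ∩ mj.1 ⊆ mk.1 ∩ mj.1 ∧ mk.1 ∩ mj.1 = mj.1 \ {x}

/-! ### Grid diagrams

The torus is cut open along one `α` (horizontal) and one `β` (vertical) circle. The circles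
`β_0, …, β_{n-1}` are numbered from left to right, `α_0, …, α_{n-1}` from bottom to top, both
cyclically. The component `(c, r)` of the complement of the circles lies between `β_c` and
`β_{c+1}` (column `c`) and between `α_r` and `α_{r+1}` (row `r`). -/

/-- A grid diagram with grid number `n`: the `X` marking of column `c` lies in row `X c`, the `O`
marking of column `c` lies in row `O c`; each component contains at most one marking. -/
structure GridDiagram (n : ℕ) where
  X : Equiv.Perm (Fin n)
  O : Equiv.Perm (Fin n)
  X_ne_O : ∀ c, X c ≠ O c

/-- The link represented by the grid diagram is a knot: moving from the `X` marking of a column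
along its row to an `O` marking, and passing to the `X` marking of the column of the latter, one
visits all columns in a single cycle. -/
def GridDiagram.IsKnot {n : ℕ} (G : GridDiagram n) : Prop :=
  (G.O⁻¹ * G.X).IsCycleOn Set.univ

/-- A generator is a formal sum of `n` intersection points, one on each `α` and each `β` circle:
the point on `β_i` is its intersection with `α_(x i)`. -/
abbrev GridGen (n : ℕ) : Type := Equiv.Perm (Fin n)

/-- A 2-chain generated by the components of the complement of the circles. -/
abbrev GridChain (n : ℕ) : Type := Fin n → Fin n → ℤ

/-- The coefficient of the part of `∂D` on the `α` circles at the arc of `α_j` from `β_i` to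
`β_{i+1}`, oriented from left to right. -/
def alphaBoundary {n : ℕ} [NeZero n] (D : GridChain n) (i j : Fin n) : ℤ :=
  D i j - D i (j - 1)

/-- `D` is a domain connecting `x` to `y`, that is, `∂(∂D|_α) = y - x`. -/
def Connects {n : ℕ} [NeZero n] (D : GridChain n) (x y : GridGen n) : Prop :=
  ∀ i j : Fin n, alphaBoundary D (i - 1) j - alphaBoundary D i j =
    (if y i = j then 1 else 0) - (if x i = j then 1 else 0)

/-- `D` is a positive domain from `x` to `y` which has coefficient `a c` at the `X` marking of
column `c` and coefficient `b c` at the `O` marking of column `c`. -/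
structure GridDiagram.PosDomain {n : ℕ} [NeZero n] (G : GridDiagram n) (x y : GridGen n)
    (a b : Fin n → ℤ) (D : GridChain n) : Prop where
  connects : Connects D x y
  nonneg : ∀ c r, 0 ≤ D c r
  atX : ∀ c, D c (G.X c) = a c
  atO : ∀ c, D c (G.O c) = b c

/-- An element `x ∏ U_c ^ (k c)` of the minus version of the generators; the variables are indexed
by the `O` markings, and these by their columns. -/
@[ext] structure MinusGen (n : ℕ) where
  gen : GridGen n
  exp : Fin n → ℕ

/-- The order `y ≼ x` on the generators of `G` (hat version): there is a positive domain from `x`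
to `y` which avoids all markings. -/
def GridDiagram.HatLE {n : ℕ} [NeZero n] (G : GridDiagram n) (y x : GridGen n) : Prop :=
  ∃ D, G.PosDomain x y 0 0 D

/-- The order `y ≼ x` in the minus version for `G`: there is a positive domain from `x`
to `y` which avoids the `X` markings and whose coefficients at the `O` markings are the
differences of the exponents. -/
def GridDiagram.MinusLE {n : ℕ} [NeZero n] (G : GridDiagram n) (y x : MinusGen n) : Prop :=
  ∃ D, G.PosDomain x.gen y.gen 0 (fun c => (y.exp c : ℤ) - x.exp c) D

/-! The relations above and below are partial orders; the following facts establish this. -/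

theorem Connects.zero {n : ℕ} [NeZero n] (x : GridGen n) : Connects 0 x x := by
  intro i j
  simp [alphaBoundary]

theorem Connects.add {n : ℕ} [NeZero n] {D E : GridChain n} {x y z : GridGen n}
    (h : Connects D x y) (h' : Connects E y z) : Connects (D + E) x z := by
  intro i j
  have h1 := h i j
  have h2 := h' i j
  simp only [alphaBoundary, Pi.add_apply] at *
  linarith

theorem Connects.eq_of_zero {n : ℕ} [NeZero n] {x y : GridGen n} (h : Connects 0 x y) :
    x = y := by
  ext1 i
  have h1 := h i (y i)
  by_contra hne
  simp [alphaBoundary, hne] at h1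

theorem fin_cyclic_const {n : ℕ} [NeZero n] (f : Fin n → ℤ) (h : ∀ i, f (i - 1) = f i)
    (i : Fin n) : f i = f 0 := by
  obtain ⟨m, rfl⟩ := Nat.exists_eq_succ_of_ne_zero (NeZero.ne n)
  induction i using Fin.induction with
  | zero => rfl
  | succ i ih =>
    rw [← h, ← ih]
    congr 1
    rw [← Fin.coeSucc_eq_succ, add_sub_cancel_right]

theorem Connects.eq_zero {n : ℕ} [NeZero n] {D : GridChain n} {x : GridGen n}
    (h : Connects D x x) (hD : ∀ c r, 0 ≤ D c r) (σ : Equiv.Perm (Fin n))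
    (hσ : ∀ c, D c (σ c) = 0) : D = 0 := by
  have h1 : ∀ i j, D i j - D i (j - 1) = D 0 j - D 0 (j - 1) := fun i j =>
    fin_cyclic_const (fun i => D i j - D i (j - 1))
      (fun i => by have := h i j; simp only [alphaBoundary] at this; linarith) i
  have h2 : ∀ i j, D i j - D 0 j = D i 0 - D 0 0 := fun i j =>
    fin_cyclic_const (fun j => D i j - D 0 j) (fun j => by linarith [h1 i j]) j
  have h3 : ∀ τ : Equiv.Perm (Fin n),
      ∑ i, D i (τ i) = ∑ i, (D i 0 - D 0 0) + ∑ i, D 0 i := by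
    intro τ
    rw [← Equiv.sum_comp τ (fun i => D 0 i), ← Finset.sum_add_distrib]
    exact Finset.sum_congr rfl fun i _ => by linarith [h2 i (τ i)]
  funext i j
  have h4 : ∑ c, D c (Equiv.swap i j c) = 0 := by
    rw [h3, ← h3 σ]
    exact Finset.sum_eq_zero fun c _ => hσ c
  have h5 := (Finset.sum_eq_zero_iff_of_nonneg fun c _ => hD c _).1 h4 i (Finset.mem_univ i)
  simpa using h5

namespace GridDiagram

variable {n : ℕ} [NeZero n] {G : GridDiagram n}

theorem PosDomain.zero (x : GridGen n) : G.PosDomain x x 0 0 0 :=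
  ⟨Connects.zero x, fun _ _ => le_rfl, fun _ => rfl, fun _ => rfl⟩

theorem PosDomain.add {x y z : GridGen n} {a b a' b' : Fin n → ℤ} {D E : GridChain n}
    (h : G.PosDomain x y a b D) (h' : G.PosDomain y z a' b' E) :
    G.PosDomain x z (a + a') (b + b') (D + E) :=
  ⟨h.connects.add h'.connects, fun c r => add_nonneg (h.nonneg c r) (h'.nonneg c r),
    fun c => by simp [h.atX, h'.atX], fun c => by simp [h.atO, h'.atO]⟩

theorem PosDomain.antisymm {x y : GridGen n} {b b' : Fin n → ℤ} {D E : GridChain n}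
    (h : G.PosDomain x y 0 b D) (h' : G.PosDomain y x 0 b' E) : x = y ∧ D = 0 := by
  have hs := h.add h'
  have h0 : D + E = 0 := hs.connects.eq_zero hs.nonneg G.X (fun c => by simp [hs.atX])
  have hD : D = 0 := by
    funext c r
    have h1 : D c r + E c r = 0 := congrFun (congrFun h0 c) r
    have h2 := h.nonneg c r
    have h3 := h'.nonneg c r
    simp only [Pi.zero_apply]
    omega
  refine ⟨?_, hD⟩
  have h1 := h.connects
  rw [hD] at h1
  exact h1.eq_of_zero

theorem HatLE.refl (x : GridGen n) : G.HatLE x x := ⟨0, PosDomain.zero x⟩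

theorem HatLE.trans {x y z : GridGen n} (h : G.HatLE z y) (h' : G.HatLE y x) : G.HatLE z x := by
  obtain ⟨D, hD⟩ := h
  obtain ⟨E, hE⟩ := h'
  exact ⟨E + D, by simpa using hE.add hD⟩

theorem HatLE.antisymm {x y : GridGen n} (h : G.HatLE y x) (h' : G.HatLE x y) : x = y := by
  obtain ⟨D, hD⟩ := h
  obtain ⟨E, hE⟩ := h'
  exact (hD.antisymm hE).1

theorem MinusLE.refl (x : MinusGen n) : G.MinusLE x x :=
  ⟨0, Connects.zero x.gen, fun _ _ => le_rfl, fun _ => rfl, fun _ => by simp⟩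

theorem MinusLE.trans {x y z : MinusGen n} (h : G.MinusLE z y) (h' : G.MinusLE y x) :
    G.MinusLE z x := by
  obtain ⟨D, hD⟩ := h
  obtain ⟨E, hE⟩ := h'
  refine ⟨E + D, ?_⟩
  have h1 := hE.add hD
  refine ⟨h1.connects, h1.nonneg, fun c => by simp [h1.atX], fun c => ?_⟩
  rw [h1.atO]
  simp only [Pi.add_apply]
  ring

theorem MinusLE.exp_le {x y : MinusGen n} (h : G.MinusLE y x) (c : Fin n) :
    x.exp c ≤ y.exp c := by
  obtain ⟨D, hD⟩ := h
  have h1 := hD.nonneg c (G.O c)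
  rw [hD.atO] at h1
  omega

theorem MinusLE.antisymm {x y : MinusGen n} (h : G.MinusLE y x) (h' : G.MinusLE x y) :
    x = y := by
  have h1 : ∀ c, x.exp c = y.exp c := fun c => le_antisymm (h.exp_le c) (h'.exp_le c)
  obtain ⟨D, hD⟩ := h
  obtain ⟨E, hE⟩ := h'
  exact MinusGen.ext (hD.antisymm hE).1 (funext h1)

end GridDiagram

/-! ### Stabilization diagrams

The torus of the grid diagram `H` is cut open so that the marking `X_1` at which one stabilizes
lies in the last row and the last column. In the stabilized diagram `G` the new circles are
`α_s = α_0` and `β_s = β_0`, with intersection point `ρ = (0, 0)`, and the circles `α_i`, `β_i`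
of `H` are renumbered `α_{i+1}`, `β_{i+1}`. -/

/-- A stabilization: a grid diagram `H` and an `X` marking of it (which is `X_1`). -/
structure StabilizationDiagram (N : ℕ) where
  H : GridDiagram (N + 1)
  X_last : H.X (Fin.last N) = Fin.last N

/-- The permutation of `Fin (N + 2)` with `0 ↦ 0` and `i + 1 ↦ τ i + 1`. -/
def extendPerm {N : ℕ} (τ : Equiv.Perm (Fin (N + 1))) : Equiv.Perm (Fin (N + 2)) :=
  Equiv.Perm.decomposeFin.symm (0, τ)

@[simp] theorem extendPerm_zero {N : ℕ} (τ : Equiv.Perm (Fin (N + 1))) : extendPerm τ 0 = 0 := by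
  simp [extendPerm]

@[simp] theorem extendPerm_succ {N : ℕ} (τ : Equiv.Perm (Fin (N + 1))) (i : Fin (N + 1)) :
    extendPerm τ i.succ = (τ i).succ := by
  simp [extendPerm]

namespace StabilizationDiagram

variable {N : ℕ} (S : StabilizationDiagram N)

/-- The diagram after stabilization. The marking `O_0` is at `(0, 0)` (top right of `ρ`), `X_0` is
at `(0, N + 1)` (bottom right of `ρ`, so `O_0` is directly above `X_0`), and `X_1` is
at `(N + 1, 0)` (top left of `ρ`); the component `(N + 1, N + 1)` bottom left of `ρ` is empty.
All other markings of `H` keep their places. -/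
def G : GridDiagram (N + 2) where
  X := extendPerm S.H.X * Equiv.swap 0 (Fin.last (N + 1))
  O := extendPerm S.H.O
  X_ne_O := by
    have hl : extendPerm S.H.X (Fin.last (N + 1)) = Fin.last (N + 1) := by
      rw [← Fin.succ_last, extendPerm_succ, S.X_last]
    intro c
    by_cases h0 : c = 0
    · subst h0
      simp [hl, Fin.ext_iff]
    · obtain ⟨i, rfl⟩ := Fin.exists_succ_eq.2 h0
      by_cases h1 : i.succ = Fin.last (N + 1)
      · rw [h1, Equiv.Perm.mul_apply, Equiv.swap_apply_right, extendPerm_zero, ← h1,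
          extendPerm_succ]
        exact (Fin.succ_ne_zero _).symm
      · rw [Equiv.Perm.mul_apply, Equiv.swap_apply_of_ne_of_ne h0 h1, extendPerm_succ,
          extendPerm_succ]
        exact fun h => S.H.X_ne_O i (Fin.succ_injective _ h)

/-- The inverse of the natural bijection `f` from the generators of `G` which contain `ρ` to the
generators of `H`: it adds the point `ρ` to a generator of `H`. -/
def fInv (y : GridGen (N + 1)) : GridGen (N + 2) := extendPerm y

/-- Coefficients at the `X` markings: `1` at `X_0` (the marking in column `0`), `0` elsewhere. -/
def onlyX0 : Fin (N + 2) → ℤ := fun c => if c = 0 then 1 else 0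

/-- The column (in `H`) of `O_1`, the `O` marking in the same horizontal annulus as `X_1` in `H`
and as `X_0` in `G`. In `G` its column is the successor of this one; in the same way the columns
of the other `O` markings of `H` are related to those in `G`. -/
def colO1 : Fin (N + 1) := S.H.O.symm (Fin.last N)

/-- Underlying set of the hat stabilization poset: the disjoint union of the generators of `G` and
of two copies of the generators of `H`. -/
inductive HatPoset (S : StabilizationDiagram N) : Type
  | ofG (x : GridGen (N + 2))
  | ofH (x : GridGen (N + 1))
  | ofH' (x : GridGen (N + 1))

/-- `hatLE S y x` is `y ≼ x` in the hat stabilization poset. Domains from a generator of `G` to one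
in the first copy of `H` have coefficient `1` at `X_0`, all others have coefficient `0` there;
all domains have coefficient `0` at the remaining markings. -/
def hatLE : HatPoset S → HatPoset S → Prop
  | .ofG y, .ofG x => S.G.HatLE y x
  | .ofH y, .ofH x => S.H.HatLE y x
  | .ofH' y, .ofH' x => S.H.HatLE y x
  | .ofH y, .ofG x => ∃ D, S.G.PosDomain x (fInv y) onlyX0 0 D
  | .ofH' y, .ofG x => ∃ D, S.G.PosDomain x (fInv y) 0 0 D
  | _, _ => False

/-- Underlying set of the minus stabilization poset: the disjoint union of the minus versions for
`G` and for `H`. -/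
inductive MinusPoset (S : StabilizationDiagram N) : Type
  | ofG (x : MinusGen (N + 2))
  | ofH (x : MinusGen (N + 1))

/-- `minusLE S y x` is `y ≼ x` in the minus stabilization poset. For `x = x' ∏ U_i ^ (n i)` from
`G`, `y = y' ∏ U_i ^ (l i)` from `H`, and a positive domain from `x'` to `y'` with
coefficients `1` at `X_0`, `0` at the other `X` markings and `k i` at `O_i`, it is required
that `l i = n i + k i` for `i > 1` and `l 1 = n 0 + n 1 + k 0 + k 1`. -/
def minusLE : MinusPoset S → MinusPoset S → Prop
  | .ofG y, .ofG x => S.G.MinusLE y x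
  | .ofH y, .ofH x => S.H.MinusLE y x
  | .ofH y, .ofG x => ∃ (k : Fin (N + 2) → ℕ) (D : GridChain (N + 2)),
      S.G.PosDomain x.gen (fInv y.gen) onlyX0 (fun c => (k c : ℤ)) D ∧
      ∀ c : Fin (N + 1), y.exp c =
        x.exp c.succ + k c.succ + (if c = S.colO1 then x.exp 0 + k 0 else 0)
  | .ofG _, .ofH _ => False

/-- The column or row of `H` which contains a given column or row of `G`. -/
def collapse (c : Fin (N + 2)) : Fin (N + 1) :=
  Fin.cases (Fin.last N) id c

theorem collapse_sub_one (i : Fin (N + 1)) : collapse (i.succ - 1) = i - 1 := by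
  have h : i.succ - 1 = i.castSucc := by
    rw [← Fin.coeSucc_eq_succ, add_sub_cancel_right]
  rw [h]
  cases i using Fin.cases with
  | zero =>
    have h1 : (0 : Fin (N + 1)) - 1 = Fin.last N := by
      rw [sub_eq_iff_eq_add]
      exact (Fin.last_add_one N).symm
    rw [h1]
    rfl
  | succ j =>
    cases N with
    | zero => exact j.elim0
    | succ N =>
      have h1 : (j.succ : Fin (N + 2)) - 1 = j.castSucc := by
        rw [← Fin.coeSucc_eq_succ, add_sub_cancel_right]
      rw [h1, ← Fin.succ_castSucc]
      simp [collapse]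

theorem collapse_zero_sub_one : collapse ((0 : Fin (N + 2)) - 1) = collapse (0 : Fin (N + 2)) := by
  have h : (0 : Fin (N + 2)) - 1 = (Fin.last N).succ := by
    rw [sub_eq_iff_eq_add, Fin.succ_last]
    exact (Fin.last_add_one (N + 1)).symm
  rw [h]
  rfl

theorem collapse_last : collapse (Fin.last (N + 1)) = Fin.last N := by
  rw [← Fin.succ_last]
  rfl

/-- A 2-chain of `H`, considered as a 2-chain of `G`. -/
def liftChain (D : GridChain (N + 1)) : GridChain (N + 2) :=
  fun c r => D (collapse c) (collapse r)

variable {S}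

theorem liftChain_posDomain {y z : GridGen (N + 1)} {b : Fin (N + 1) → ℤ} {D : GridChain (N + 1)}
    (h : S.H.PosDomain y z 0 b D) :
    S.G.PosDomain (fInv y) (fInv z) 0 (Fin.cons 0 b) (liftChain D) := by
  have hl : D (Fin.last N) (Fin.last N) = 0 := by
    have h1 := h.atX (Fin.last N)
    rwa [S.X_last] at h1
  refine ⟨?_, fun c r => h.nonneg _ _, ?_, ?_⟩
  · intro i j
    simp only [alphaBoundary, liftChain, fInv]
    cases i using Fin.cases with
    | zero => rw [collapse_zero_sub_one]; simp
    | succ i =>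
      cases j using Fin.cases with
      | zero =>
        rw [collapse_zero_sub_one]
        simp [Fin.succ_ne_zero]
      | succ j =>
        rw [collapse_sub_one, collapse_sub_one]
        simpa [alphaBoundary, collapse] using h.connects i j
  · intro c
    have hL : extendPerm S.H.X (Fin.last (N + 1)) = Fin.last (N + 1) := by
      rw [← Fin.succ_last, extendPerm_succ, S.X_last]
    simp only [liftChain, G, Pi.zero_apply, Equiv.Perm.mul_apply]
    by_cases h0 : c = 0
    · subst h0
      rw [Equiv.swap_apply_left, hL, collapse_last]
      exact hl
    · by_cases h1 : c = Fin.last (N + 1)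
      · subst h1
        rw [Equiv.swap_apply_right, extendPerm_zero, collapse_last]
        exact hl
      · rw [Equiv.swap_apply_of_ne_of_ne h0 h1]
        obtain ⟨i, rfl⟩ := Fin.exists_succ_eq.2 h0
        rw [extendPerm_succ]
        simpa [collapse] using h.atX i
  · intro c
    cases c using Fin.cases with
    | zero => simpa [liftChain, G, collapse] using hl
    | succ i => simpa [liftChain, G, collapse] using h.atO i

instance : PartialOrder (HatPoset S) where
  le := hatLE S
  le_refl x := by
    cases x <;> exact GridDiagram.HatLE.refl _
  le_trans z y x h h' := by
    cases x <;> cases y <;> cases z <;> first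
      | exact h.elim
      | exact h'.elim
      | exact GridDiagram.HatLE.trans h h'
      | skip
    all_goals
      obtain ⟨D, hD⟩ := h
      obtain ⟨E, hE⟩ := h'
      first
        | exact ⟨E + D, by simpa using hE.add hD⟩
        | refine ⟨E + liftChain D, ?_⟩
          have h1 := hE.add (liftChain_posDomain hD)
          refine ⟨h1.connects, h1.nonneg, fun c => by simp [h1.atX], fun c => ?_⟩
          rw [h1.atO]
          cases c using Fin.cases <;> simp
  le_antisymm y x h h' := by
    cases x <;> cases y <;> first
      | exact h.elim
      | exact h'.elim
      | exact congrArg _ (GridDiagram.HatLE.antisymm h h').symm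

instance : PartialOrder (MinusPoset S) where
  le := minusLE S
  le_refl x := by
    cases x <;> exact GridDiagram.MinusLE.refl _
  le_trans z y x h h' := by
    cases x <;> cases y <;> cases z <;> first
      | exact h.elim
      | exact h'.elim
      | exact GridDiagram.MinusLE.trans h h'
      | skip
    · rename_i x y z
      have hle := fun c => GridDiagram.MinusLE.exp_le (G := S.G) h' c
      obtain ⟨k, D, hD, hk⟩ := h
      obtain ⟨E, hE⟩ := h'
      refine ⟨fun c => k c + (y.exp c - x.exp c), E + D, ?_, fun c => ?_⟩
      · have h1 := hE.add hD
        refine ⟨h1.connects, h1.nonneg, fun c => by simp [h1.atX], fun c => ?_⟩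
        rw [h1.atO]
        have := hle c
        simp only [Pi.add_apply]
        omega
      · have h0 := hle 0
        have h1 := hle c.succ
        rw [hk c]
        dsimp only
        split_ifs <;> omega
    · rename_i x y z
      have hle := fun c => GridDiagram.MinusLE.exp_le (G := S.H) h c
      obtain ⟨k, E, hE, hk⟩ := h'
      obtain ⟨D, hD⟩ := h
      refine ⟨Fin.cons (k 0) (fun c => k c.succ + (z.exp c - y.exp c)), E + liftChain D, ?_,
        fun c => ?_⟩
      · have h1 := hE.add (liftChain_posDomain hD)
        refine ⟨h1.connects, h1.nonneg, fun c => by simp [h1.atX], fun c => ?_⟩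
        rw [h1.atO]
        cases c using Fin.cases with
        | zero => simp
        | succ i =>
          have := hle i
          simp only [Pi.add_apply, Fin.cons_succ]
          omega
      · have h0 := hle c
        have h1 := hk c
        simp only [Fin.cons_succ, Fin.cons_zero]
        split_ifs at * <;> omega
  le_antisymm y x h h' := by
    cases x <;> cases y <;> first
      | exact h.elim
      | exact h'.elim
      | exact congrArg _ (GridDiagram.MinusLE.antisymm h h').symm

end StabilizationDiagram

/-! ### Lexicographic shellability -/

/-! Both posets are lexicographically shellable. The coverings in the minus poset are empty
rectangles, labelled by the left side and then by the right side. The maximal chains of an interval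
are ordered lexicographically by their label sequences. Less is needed than a unique rising chain in
each interval: at a descent there is another first step with a smaller label (`improve`), and a
first step that is not the least one towards `q` can be followed by a step towards `q` with a
smaller label (`descend`). By the latter, a rising stretch begins with the least label. So a
lexicographically larger chain has a descent strictly inside the first stretch where it differs from
a smaller one, and `improve` removes this descent by changing one element (`IsPath.exchange`).

For rectangles the geometric input is a staircase argument (`exists_staircase_corner`). If a
positive domain has a zero in each row and column, its support cannot close up around the torus, and
each component of the support has points of the initial generator to its upper right and lower left.
This yields empty rectangles inside the domain. `hasSmallerRect_add` then gives `improve`, and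
`hasSmallerRect_sub` gives `descend`; the latter also uses that for a knot the domain between two
elements is unique, so that two competing first steps lie in one domain. Gradedness comes from an
additive index that has the same value on all empty rectangles.

Uniqueness and the zeros can fail only between a generator of `G` containing `ρ` and an element from
`H`. There the vertical annulus of `X_0` and `O_0` and the horizontal annulus of `X_0` and `O_1` are
interchangeable, because `U_0` and `U_1` are identified. However, the rectangle of width one to the
right of `ρ` is then always available, and it has the least label of all.

The hat poset is the part with trivial exponents, with the generators containing `ρ` doubled. The
passage to the second copy is a covering of label `0`. -/

/-- Data making a poset edge-lexicographically shellable on closed intervals. `step p u l` means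
that `u` is covered by `p` and that `l` is an admissible label of this covering. -/
structure EdgeLabelling (P : Type*) [PartialOrder P] where
  step : P → P → ℕ → Prop
  len : P → P → ℤ
  step_lt : ∀ {p u l}, step p u l → u < p
  exists_step : ∀ {p q}, q < p → ∃ u l, step p u l ∧ q ≤ u
  len_add : ∀ {p q r}, r ≤ q → q ≤ p → len p r = len p q + len q r
  len_nonneg : ∀ {p q}, q ≤ p → 0 ≤ len p q
  -- Lengths are counted in quarters: the index of a domain is later taken as a sum over four
  -- components around each point rather than an average.
  len_step : ∀ {p u l}, step p u l → len p u = 4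
  improve : ∀ {a b c l l'}, step a b l → step b c l' → l' < l →
    ∃ b' m, step a b' m ∧ c ≤ b' ∧ m < l
  descend : ∀ {p q z w l m}, step p z l → step p w m → q ≤ z → q ≤ w → m < l →
    ∃ u k, step z u k ∧ q ≤ u ∧ k < l
  step_inj : ∀ {p w z l}, step p w l → step p z l → w = z

namespace EdgeLabelling

variable {P : Type*} [PartialOrder P] (E : EdgeLabelling P)

theorem len_self (p : P) : E.len p p = 0 := by
  have := E.len_add (le_refl p) (le_refl p)
  omega

theorem four_le_len {p q : P} (h : q < p) : 4 ≤ E.len p q := by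
  obtain ⟨u, l, hs, hq⟩ := E.exists_step h
  have h1 := E.len_add hq (E.step_lt hs).le
  have h2 := E.len_step hs
  have h3 := E.len_nonneg hq
  omega

theorem eq_of_len_le {p q : P} (h : q ≤ p) (h4 : E.len p q < 4) : q = p := by
  by_contra hne
  have := E.four_le_len (lt_of_le_of_ne h hne)
  omega

/-- Steps are coverings, because every strict relation already has length at least `4`. -/
theorem eq_of_step_of_le {p u v : P} {l : ℕ} (h : E.step p u l) (huv : u ≤ v) (hvp : v < p) :
    v = u := by
  have h1 := E.len_add huv hvp.le
  have h2 := E.len_step h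
  have h3 := E.four_le_len hvp
  exact (E.eq_of_len_le huv (by omega)).symm

/-- Restriction of a labelling to a closed interval. -/
def icc (y x : P) : EdgeLabelling (Set.Icc y x) where
  step p u l := E.step p u l
  len p q := E.len p q
  step_lt h := E.step_lt h
  exists_step {p q} h := by
    obtain ⟨u, l, hs, hq⟩ := E.exists_step (Subtype.coe_lt_coe.2 h)
    exact ⟨⟨u, q.2.1.trans hq, (E.step_lt hs).le.trans p.2.2⟩, l, hs, hq⟩
  len_add h h' := E.len_add h h'
  len_nonneg h := E.len_nonneg h
  len_step h := E.len_step h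
  improve {a b c l l'} h h' hl := by
    obtain ⟨b', m, hs, hc, hm⟩ := E.improve h h' hl
    exact ⟨⟨b', c.2.1.trans hc, (E.step_lt hs).le.trans a.2.2⟩, m, hs, hc, hm⟩
  descend {p q z w l m} h h' hz hw hl := by
    obtain ⟨u, k, hs, hc, hm⟩ := E.descend h h' hz hw hl
    exact ⟨⟨u, q.2.1.trans hc, (E.step_lt hs).le.trans z.2.2⟩, k, hs, hc, hm⟩
  step_inj h h' := Subtype.ext (E.step_inj h h')

/-- The least admissible label of a covering. -/
noncomputable def lab (p u : P) : ℕ := sInf {l | E.step p u l}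

theorem step_lab {p u : P} {l : ℕ} (h : E.step p u l) : E.step p u (E.lab p u) :=
  Nat.sInf_mem (s := {l | E.step p u l}) ⟨l, h⟩

theorem lab_le {p u : P} {l : ℕ} (h : E.step p u l) : E.lab p u ≤ l :=
  Nat.sInf_le (s := {l | E.step p u l}) h

/-- A saturated chain from `x` down to `y`, which is constant from some index on. -/
structure IsPath (x y : P) (L : ℕ) (c : ℕ → P) : Prop where
  zero : c 0 = x
  step : ∀ k < L, E.step (c k) (c (k + 1)) (E.lab (c k) (c (k + 1)))
  eq_bot : ∀ k, L ≤ k → c k = y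

variable {E} {x y : P} {L : ℕ} {c : ℕ → P}

namespace IsPath

theorem succ_le (h : E.IsPath x y L c) (k : ℕ) : c (k + 1) ≤ c k := by
  rcases lt_or_ge k L with hk | hk
  · exact (E.step_lt (h.step k hk)).le
  · rw [h.eq_bot k hk, h.eq_bot (k + 1) (by omega)]

theorem anti (h : E.IsPath x y L c) : Antitone c := antitone_nat_of_succ_le h.succ_le

theorem len_eq (h : E.IsPath x y L c) {k : ℕ} (hk : k ≤ L) : E.len x (c k) = 4 * k := by
  induction k with
  | zero => rw [h.zero, E.len_self]; rfl
  | succ k ih =>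
    have hs := h.step k (by omega)
    rw [E.len_add (q := c k) (E.step_lt hs).le (h.zero ▸ h.anti (Nat.zero_le k)),
      ih (by omega), E.len_step hs]
    push_cast
    ring

/-- The length measured from `x` fixes the position of an element, so paths with common ends can
meet only at equal indices. -/
theorem index_eq (h : E.IsPath x y L c) {c' : ℕ → P} (h' : E.IsPath x y L c') {i j : ℕ}
    (hi : i ≤ L) (hj : j ≤ L) (hij : c i = c' j) : i = j := by
  have h1 := h.len_eq hi
  have h2 := h'.len_eq hj
  rw [hij] at h1
  omega

theorem isMaxChain (h : E.IsPath x y L c) (hx : ∀ z : P, z ≤ x) (hy : ∀ z : P, y ≤ z) :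
    IsMaxChain (· ≤ ·) (Set.range c) := by
  refine ⟨?_, fun t ht hct => le_antisymm hct fun v hv => ?_⟩
  · rintro _ ⟨i, rfl⟩ _ ⟨j, rfl⟩ _
    rcases le_total i j with hij | hij
    · exact Or.inr (h.anti hij)
    · exact Or.inl (h.anti hij)
  · by_contra hne
    -- An element comparable to the path but not on it does not fit inside any covering, so it is
    -- pushed below each `c k` in turn.
    have hcv : ∀ k, v ≤ c k := by
      intro k
      induction k with
      | zero => rw [h.zero]; exact hx v
      | succ k ih =>
        rcases ht.total hv (hct ⟨k + 1, rfl⟩) with h1 | h1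
        · exact h1
        · have h3 : v ≠ c k := fun h4 => hne ⟨k, h4.symm⟩
          rcases lt_or_ge k L with hk | hk
          · exact (E.eq_of_step_of_le (h.step k hk) h1 (lt_of_le_of_ne ih h3)).le
          · exact absurd (le_antisymm (ih.trans (h.eq_bot k hk).le) (hy v))
              (by rw [← h.eq_bot k hk]; exact h3)
    exact hne ⟨L, le_antisymm ((h.eq_bot L le_rfl).le.trans (hy v)) (hcv L)⟩

theorem encard_range (h : E.IsPath x y L c) : (Set.range c).encard = L + 1 := by
  have h1 : Set.range c = c '' (Finset.range (L + 1) : Finset ℕ) := by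
    ext v
    constructor
    · rintro ⟨k, rfl⟩
      rcases le_or_gt k L with hk | hk
      · exact ⟨k, by simp; omega, rfl⟩
      · exact ⟨L, by simp, by rw [h.eq_bot L le_rfl, h.eq_bot k hk.le]⟩
    · rintro ⟨k, _, rfl⟩
      exact ⟨k, rfl⟩
  rw [h1, Set.InjOn.encard_image, Set.encard_coe_eq_coe_finsetCard, Finset.card_range]
  · rfl
  · intro i hi j hj hij
    simp only [Finset.coe_range, Set.mem_Iio] at hi hj
    exact h.index_eq h (by omega) (by omega) hij

/-- On a path whose labels weakly increase, the first label is the least one possible. -/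
theorem le_of_rising (h : E.IsPath x y L c) {k j : ℕ} (hkj : k < j) (hj : j ≤ L)
    (hr : ∀ t, k < t → t < j → E.lab (c (t - 1)) (c t) ≤ E.lab (c t) (c (t + 1)))
    {w : P} {m : ℕ} (hw : E.step (c k) w m) (hq : c j ≤ w) : E.lab (c k) (c (k + 1)) ≤ m := by
  induction hn : j - k generalizing k w m with
  | zero => omega
  | succ d ih =>
    -- A smaller first step yields, by `descend`, a step from `c (k + 1)` with a label below the
    -- first one. By induction the second label of the path is at most that, so the path would
    -- descend.
    by_contra! hlt
    rcases Nat.lt_or_ge (k + 1) j with h1 | h1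
    · obtain ⟨u, m', hu, hqu, hm'⟩ :=
        E.descend (h.step k (by omega)) hw (h.anti h1.le) hq hlt
      have h2 := ih (k := k + 1) h1 (fun t ht => hr t (by omega)) hu hqu (by omega)
      have h3 := hr (k + 1) (by omega) h1
      simp only [Nat.add_sub_cancel] at h3
      omega
    · have hjk : j = k + 1 := by omega
      subst hjk
      have h2 := E.eq_of_step_of_le (h.step k (by omega)) hq (E.step_lt hw)
      subst h2
      have := E.lab_le hw
      omega

/-- The two old steps have total length `8` and the new first step uses `4`. The remaining `4` leave
room for exactly one step from `b`, which must end at `c (t + 2)`. -/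
theorem update (h : E.IsPath x y L c) {t : ℕ} (ht : t + 2 ≤ L) {b : P} {m : ℕ}
    (hb : E.step (c t) b m) (hc : c (t + 2) ≤ b) :
    E.IsPath x y L (Function.update c (t + 1) b) := by
  have hs : ∃ l, E.step b (c (t + 2)) l := by
    have h1 := E.len_add hc (E.step_lt hb).le
    have h2 := E.len_step hb
    have h3 := h.step t (by omega)
    have h4 := h.step (t + 1) (by omega)
    have h5 := E.len_add (E.step_lt h4).le (E.step_lt h3).le
    rw [E.len_step h3, E.len_step h4] at h5
    have h6 : c (t + 2) < b := by
      refine lt_of_le_of_ne hc fun h7 => ?_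
      rw [h7, E.len_self] at h1
      rw [← h7] at h2
      simp only [Nat.add_assoc, Nat.reduceAdd] at h5
      omega
    obtain ⟨u, l, hu, hcu⟩ := E.exists_step h6
    have h7 := E.len_add hcu (E.step_lt hu).le
    have h8 := E.len_step hu
    simp only [Nat.add_assoc, Nat.reduceAdd] at h5
    have h9 := E.eq_of_len_le hcu (by omega)
    exact ⟨l, h9 ▸ hu⟩
  obtain ⟨l, hs⟩ := hs
  refine ⟨?_, fun k hk => ?_, fun k hk => ?_⟩
  · rw [Function.update_of_ne (by omega), h.zero]
  · rcases eq_or_ne k t with rfl | h1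
    · rw [Function.update_of_ne (by omega), Function.update_self]
      exact E.step_lab hb
    · rcases eq_or_ne k (t + 1) with rfl | h2
      · rw [Function.update_self, Function.update_of_ne (by omega)]
        exact E.step_lab hs
      · rw [Function.update_of_ne h2, Function.update_of_ne (by omega)]
        exact h.step k hk
  · rw [Function.update_of_ne (by omega), h.eq_bot k hk]

/-- The sequence of labels of a path. -/
noncomputable def labels (E : EdgeLabelling P) (c : ℕ → P) : Lex (ℕ → ℕ) :=
  toLex fun k => E.lab (c k) (c (k + 1))

theorem eq_of_labels_eq (h : E.IsPath x y L c) {c' : ℕ → P} (h' : E.IsPath x y L c') {k : ℕ}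
    (hl : ∀ j < k, E.lab (c j) (c (j + 1)) = E.lab (c' j) (c' (j + 1))) : c k = c' k := by
  induction k with
  | zero => rw [h.zero, h'.zero]
  | succ k ih =>
    have h1 := ih fun j hj => hl j (by omega)
    rcases lt_or_ge k L with hk | hk
    · have h2 := h.step k hk
      have h3 := h'.step k hk
      rw [← hl k (by omega), ← h1] at h3
      exact E.step_inj h2 h3
    · rw [h.eq_bot _ (by omega), h'.eq_bot _ (by omega)]

/-- The exchange property of the lexicographic order of paths. -/
theorem exchange (h : E.IsPath x y L c) {c' : ℕ → P} (h' : E.IsPath x y L c')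
    (hlt : labels E c' < labels E c) :
    ∃ c'', E.IsPath x y L c'' ∧ labels E c'' < labels E c ∧ ∃ v ∈ Set.range c,
      Set.range c' ∩ Set.range c ⊆ Set.range c'' ∩ Set.range c ∧
      Set.range c'' ∩ Set.range c = Set.range c \ {v} := by
  obtain ⟨k, hk, hkl⟩ := hlt
  change ∀ j < k, E.lab (c' j) (c' (j + 1)) = E.lab (c j) (c (j + 1)) at hk
  change E.lab (c' k) (c' (k + 1)) < E.lab (c k) (c (k + 1)) at hkl
  have hck : c' k = c k := h'.eq_of_labels_eq h hk
  -- From index `L` on both paths are constantly `y`, so their labels agree there.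
  have hkL : k < L := by
    by_contra hcon
    rw [h.eq_bot k (by omega), h.eq_bot (k + 1) (by omega), h'.eq_bot k (by omega),
      h'.eq_bot (k + 1) (by omega)] at hkl
    omega
  classical
  -- `j` is the first index after the splitting point `k` at which the paths meet again.
  have hex : ∃ j, k < j ∧ c' j = c j := ⟨L, hkL, by rw [h.eq_bot L le_rfl, h'.eq_bot L le_rfl]⟩
  set j := Nat.find hex with hjdef
  obtain ⟨hkj, hcj⟩ : k < j ∧ c' j = c j := Nat.find_spec hex
  have hjL : j ≤ L := Nat.find_min' hex ⟨hkL, by rw [h.eq_bot L le_rfl, h'.eq_bot L le_rfl]⟩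
  -- Without a descent of `c` between `k` and `j`, its label at `k` would be the least one towards
  -- `c j`, yet `c'` does better.
  have hdesc : ∃ t, k < t ∧ t < j ∧ E.lab (c t) (c (t + 1)) < E.lab (c (t - 1)) (c t) := by
    by_contra! hcon
    have h1 := h'.step k hkL
    rw [hck] at h1 hkl
    have h2 := h.le_of_rising hkj hjL hcon h1 (hcj ▸ h'.anti hkj)
    omega
  obtain ⟨t, hkt, htj, hd⟩ := hdesc
  obtain ⟨s, rfl⟩ : ∃ s, t = s + 1 := ⟨t - 1, by omega⟩
  simp only [Nat.add_sub_cancel] at hd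
  have hs1 := h.step s (by omega)
  have hs2 := h.step (s + 1) (by omega)
  obtain ⟨b, m, hb, hcb, hm⟩ := E.improve hs1 hs2 hd
  have hnew := h.update (by omega) hb hcb
  have hlab := E.lab_le hb
  have hbne : b ≠ c (s + 1) := by
    rintro rfl
    omega
  refine ⟨_, hnew, ⟨s, fun i hi => ?_, ?_⟩, c (s + 1), ⟨_, rfl⟩, ?_, ?_⟩
  · change E.lab _ _ = E.lab _ _
    rw [Function.update_of_ne (by omega), Function.update_of_ne (by omega)]
  · change E.lab _ _ < E.lab _ _
    rw [Function.update_of_ne (by omega), Function.update_self]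
    omega
  -- Common elements occur at equal indices, and the replaced index lies strictly between `k` and
  -- `j`, where the paths do not meet.
  · rintro _ ⟨⟨i, rfl⟩, ⟨i', hi'⟩⟩
    have key : ∃ i ≤ L, c' i = c i ∧ c i = c i' := by
      have hi1 : c' (min i L) = c' i := by
        rcases le_total i L with h1 | h1
        · rw [min_eq_left h1]
        · rw [min_eq_right h1, h'.eq_bot i h1, h'.eq_bot L le_rfl]
      have hi2 : c (min i' L) = c i' := by
        rcases le_total i' L with h1 | h1
        · rw [min_eq_left h1]
        · rw [min_eq_right h1, h.eq_bot i' h1, h.eq_bot L le_rfl]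
      have h3 := h.index_eq h' (min_le_right i' L) (min_le_right i L) (by rw [hi1, hi2, hi'])
      refine ⟨min i' L, min_le_right _ _, ?_, hi2⟩
      rw [hi2, h3, hi1, hi']
    obtain ⟨i₀, hi₀L, h1, h2⟩ := key
    rw [← hi', ← h2]
    refine ⟨⟨i₀, ?_⟩, ⟨i₀, rfl⟩⟩
    rw [Function.update_of_ne]
    rintro rfl
    exact Nat.find_min hex htj ⟨hkt, h1⟩
  · ext v
    constructor
    · rintro ⟨⟨i, rfl⟩, ⟨i', hi'⟩⟩
      refine ⟨⟨i', hi'⟩, fun hv => ?_⟩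
      rw [Set.mem_singleton_iff] at hv
      rcases eq_or_ne i (s + 1) with rfl | h1
      · rw [Function.update_self] at hv
        exact hbne hv
      · rw [Function.update_of_ne h1] at hv
        rcases le_or_gt i L with h2 | h2
        · exact h1 (h.index_eq h h2 (by omega) hv)
        · rw [h.eq_bot i h2.le, ← h.eq_bot L le_rfl] at hv
          have := h.index_eq h le_rfl (by omega) hv
          omega
    · rintro ⟨⟨i, rfl⟩, hv⟩
      refine ⟨⟨i, ?_⟩, ⟨i, rfl⟩⟩
      rw [Function.update_of_ne]
      rintro rfl
      exact hv rfl

end IsPath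

/-! ### Maximal chains as paths, and shellability of bounded posets -/

theorem exists_step_of_isMaxChain (E : EdgeLabelling P) (hy : ∀ z : P, y ≤ z) {s : Set P}
    (hs : IsMaxChain (· ≤ ·) s) {z : P} (hz : z ∈ s) (hzy : z ≠ y) :
    ∃ w ∈ s, ∃ l, E.step z w l := by
  have hins : ∀ u : P, (∀ v ∈ s, u ≤ v ∨ v ≤ u) → u ∈ s := by
    intro u hu
    have h1 : IsChain (· ≤ ·) (insert u s) := hs.1.insert fun v hv _ => hu v hv
    rw [hs.2 h1 (Set.subset_insert _ _)]
    exact Set.mem_insert _ _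
  have hys : y ∈ s := hins y fun v _ => Or.inl (hy v)
  -- `w` is the element of the chain next below `z`. A step from `z` towards `w` is comparable to
  -- the whole chain and hence belongs to it.
  obtain ⟨w, ⟨hws, hwz⟩, hmin⟩ := (measure fun w => (E.len z w).toNat).wf.has_min
    {w | w ∈ s ∧ w < z} ⟨y, hys, lt_of_le_of_ne (hy z) hzy.symm⟩
  obtain ⟨u, l, hu, hwu⟩ := E.exists_step hwz
  refine ⟨u, hins u fun v hv => ?_, l, hu⟩
  have huz := E.step_lt hu
  rcases hs.1.total hz hv with h1 | h1
  · exact Or.inl (huz.le.trans h1)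
  · rcases eq_or_lt_of_le h1 with rfl | h1
    · exact Or.inl huz.le
    · refine Or.inr ?_
      rcases hs.1.total hv hws with h2 | h2
      · exact h2.trans hwu
      · rcases eq_or_lt_of_le h2 with rfl | h2
        · exact hwu
        · have h3 : ¬ (E.len z v).toNat < (E.len z w).toNat := hmin v ⟨hv, h1⟩
          have h4 := E.len_add h2.le h1.le
          have h5 := E.four_le_len h2
          have h6 := E.len_nonneg h1.le
          omega

theorem exists_path_of_isMaxChain (E : EdgeLabelling P) (hx : ∀ z : P, z ≤ x)
    (hy : ∀ z : P, y ≤ z) {s : Set P} (hs : IsMaxChain (· ≤ ·) s) :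
    ∃ c, E.IsPath x y (E.len x y / 4).toNat c ∧ Set.range c = s := by
  classical
  have hxs : x ∈ s := by
    have h1 : IsChain (· ≤ ·) (insert x s) := hs.1.insert fun v _ _ => Or.inr (hx v)
    rw [hs.2 h1 (Set.subset_insert _ _)]
    exact Set.mem_insert _ _
  have hnext : ∀ z : s, ∃ w : s, (z.1 = y → w.1 = y) ∧
      (z.1 ≠ y → ∃ l, E.step z w l) := by
    rintro ⟨z, hz⟩
    by_cases hzy : z = y
    · exact ⟨⟨z, hz⟩, fun h => h, fun h => absurd hzy h⟩
    · obtain ⟨w, hw, l, hl⟩ := E.exists_step_of_isMaxChain hy hs hz hzy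
      exact ⟨⟨w, hw⟩, fun h => absurd h hzy, fun _ => ⟨l, hl⟩⟩
  choose next hn1 hn2 using hnext
  let c : ℕ → s := fun k => next^[k] ⟨x, hxs⟩
  have hc : ∀ k, c (k + 1) = next (c k) := fun k => Function.iterate_succ_apply' _ _ _
  have hlen : ∀ k, (∀ j < k, (c j).1 ≠ y) → E.len x (c k) = 4 * k := by
    intro k
    induction k with
    | zero => intro _; simp [c, E.len_self]
    | succ k ih =>
      intro h
      obtain ⟨l, hl⟩ := hn2 (c k) (h k (by omega))
      rw [← hc] at hl
      rw [E.len_add (E.step_lt hl).le (hx _), ih fun j hj => h j (by omega), E.len_step hl]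
      push_cast
      ring
  -- Each step costs `4`, so a descent that never reached `y` would exceed the total length.
  have hex : ∃ k, (c k).1 = y := by
    by_contra! hcon
    have h1 := hlen ((E.len x y).toNat + 1) fun j _ => hcon j
    have h2 := E.len_add (hy (c ((E.len x y).toNat + 1))) (hx _)
    have h3 := E.len_nonneg (hy (c ((E.len x y).toNat + 1)).1)
    push_cast at h1
    omega
  have hL := hlen (Nat.find hex) fun j hj => Nat.find_min hex hj
  rw [Nat.find_spec hex] at hL
  have hL' : (E.len x y / 4).toNat = Nat.find hex := by omega
  have hp : E.IsPath x y (E.len x y / 4).toNat fun k => (c k).1 := by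
    rw [hL']
    refine ⟨rfl, fun k hk => ?_, fun k hk => ?_⟩
    · obtain ⟨l, hl⟩ := hn2 (c k) (Nat.find_min hex hk)
      rw [← hc] at hl
      exact E.step_lab hl
    · induction k, hk using Nat.le_induction with
      | base => exact Nat.find_spec hex
      | succ k _ ih => rw [hc]; exact hn1 _ ih
  refine ⟨_, hp, (hp.isMaxChain hx hy).2 hs.1 ?_⟩
  rintro _ ⟨k, rfl⟩
  exact (c k).2

theorem posetGraded (E : EdgeLabelling P) : PosetGraded P := by
  intro a b s t
  by_cases hab : a ≤ b
  · obtain ⟨c, hc, hcs⟩ := (E.icc a b).exists_path_of_isMaxChain (x := ⟨b, hab, le_rfl⟩)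
      (y := ⟨a, le_rfl, hab⟩) (fun z => z.2.2) (fun z => z.2.1) s.2
    obtain ⟨c', hc', hct⟩ := (E.icc a b).exists_path_of_isMaxChain (x := ⟨b, hab, le_rfl⟩)
      (y := ⟨a, le_rfl, hab⟩) (fun z => z.2.2) (fun z => z.2.1) t.2
    rw [← hcs, ← hct, hc.encard_range, hc'.encard_range]
  · have hemp : IsEmpty (Set.Icc a b) := ⟨fun z => hab (z.2.1.trans z.2.2)⟩
    rw [Set.eq_empty_of_isEmpty s.1, Set.eq_empty_of_isEmpty t.1]

theorem posetShellable_of_bounded (E : EdgeLabelling P) (hx : ∀ z : P, z ≤ x)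
    (hy : ∀ z : P, y ≤ z) : PosetShellable P := by
  refine ⟨E.posetGraded, ?_⟩
  choose c hc hcs using fun m : MaxChain P => E.exists_path_of_isMaxChain hx hy m.2
  have hinj : Function.Injective fun m => IsPath.labels E (c m) := by
    intro m m' h
    have h1 : c m = c m' := by
      funext k
      exact (hc m).eq_of_labels_eq (hc m') fun j _ => congrFun (congrArg ofLex h) j
    exact Subtype.ext (by rw [← hcs m, ← hcs m', h1])
  refine ⟨fun m m' => IsPath.labels E (c m) < IsPath.labels E (c m'), ?_, ?_⟩
  · exact
      { trichotomous := fun a b h1 h2 => hinj (le_antisymm (not_lt.1 h2) (not_lt.1 h1))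
        irrefl := fun _ => lt_irrefl _
        trans := fun _ _ _ => lt_trans }
  · intro mi mj hij
    obtain ⟨c'', h1, h2, v, hv, h3, h4⟩ := (hc mj).exchange (hc mi) hij
    let mk : MaxChain P := ⟨Set.range c'', h1.isMaxChain hx hy⟩
    -- The path chosen for the chain `mk` is `c''` itself: the elements are the same, and lengths
    -- determine their order.
    have h5 : c mk = c'' := by
      funext k
      have h6 : ∀ k, c mk k = c'' k := by
        intro k
        rcases le_or_gt k (E.len x y / 4).toNat with hk | hk
        · have h7 : c mk k ∈ Set.range c'' := by
            rw [show Set.range c'' = mk.1 from rfl, ← hcs mk]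
            exact ⟨k, rfl⟩
          obtain ⟨j, hj⟩ := h7
          rcases le_or_gt j (E.len x y / 4).toNat with hjL | hjL
          · rw [h1.index_eq (hc mk) hjL hk hj] at hj
            exact hj.symm
          · rw [h1.eq_bot j hjL.le, ← h1.eq_bot _ le_rfl] at hj
            rw [h1.index_eq (hc mk) le_rfl hk hj] at hj
            exact hj.symm
        · rw [(hc mk).eq_bot k hk.le, h1.eq_bot k hk.le]
      exact h6 k
    refine ⟨mk, ?_, v, ?_, ?_, ?_⟩
    · change IsPath.labels E (c mk) < _
      rw [h5]
      exact h2
    · rw [← hcs mj]; exact hv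
    · rw [← hcs mj, ← hcs mi]; exact h3
    · rw [← hcs mj]; exact h4

/-- Closed intervals of a poset with an edge labelling are shellable. -/
theorem posetShellable_icc (E : EdgeLabelling P) (y x : P) : PosetShellable (Set.Icc y x) := by
  by_cases hyx : y ≤ x
  · exact (E.icc y x).posetShellable_of_bounded (x := ⟨x, hyx, le_rfl⟩) (y := ⟨y, le_rfl, hyx⟩)
      (fun z => z.2.2) (fun z => z.2.1)
  · have hemp : IsEmpty (Set.Icc y x) := ⟨fun z => hyx (z.2.1.trans z.2.2)⟩
    have hsub : ∀ s t : MaxChain (Set.Icc y x), s = t := fun s t =>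
      Subtype.ext (by rw [Set.eq_empty_of_isEmpty s.1, Set.eq_empty_of_isEmpty t.1])
    exact ⟨(E.icc y x).posetGraded, fun _ _ => False,
      { trichotomous := fun a b _ _ => hsub a b
        irrefl := fun _ h => h
        trans := fun _ _ _ h => h.elim }, fun _ _ h => h.elim⟩

end EdgeLabelling

/-! ### Rectangles on the torus -/

section Torus

set_option linter.unusedSectionVars false

variable {n : ℕ} [NeZero n]

/-- The cyclic distance from `a` to `c`. -/
def cycDist (a c : Fin n) : ℕ := (c - a).val

theorem cycDist_spec (a c : Fin n) :
    (a.val ≤ c.val ∧ cycDist a c + a.val = c.val) ∨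
      (c.val < a.val ∧ cycDist a c + a.val = c.val + n) := by
  have ha := a.isLt
  have hc := c.isLt
  rcases le_or_gt a c with h | h
  · left
    rw [cycDist, Fin.sub_val_of_le h]
    have : a.val ≤ c.val := h
    omega
  · right
    rw [cycDist, Fin.coe_sub_iff_lt.2 h]
    have : c.val < a.val := h
    omega

theorem cycDist_lt (a c : Fin n) : cycDist a c < n := (c - a).isLt

@[simp] theorem cycDist_self (a : Fin n) : cycDist a a = 0 := by simp [cycDist]

theorem cycDist_eq_zero {a c : Fin n} : cycDist a c = 0 ↔ a = c := by
  rcases cycDist_spec a c with h | h <;> rw [Fin.ext_iff] <;> have := a.isLt <;> omega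

theorem cycDist_pos {a c : Fin n} : 0 < cycDist a c ↔ a ≠ c := by
  rw [Nat.pos_iff_ne_zero, Ne, cycDist_eq_zero]

theorem cycDist_inj {a c c' : Fin n} (h : cycDist a c = cycDist a c') : c = c' := by
  have := c.isLt
  have := c'.isLt
  rcases cycDist_spec a c with h | h <;> rcases cycDist_spec a c' with h' | h' <;>
    rw [Fin.ext_iff] <;> omega

theorem cycDist_add (a b c : Fin n) :
    cycDist a b + cycDist b c = cycDist a c ∨ cycDist a b + cycDist b c = cycDist a c + n := by
  have := cycDist_lt a b
  have := cycDist_lt b c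
  have := cycDist_lt a c
  rcases cycDist_spec a c with h | h <;> rcases cycDist_spec a b with h' | h' <;>
    rcases cycDist_spec b c with h'' | h'' <;> omega

theorem cycDist_sub_one {a c : Fin n} (h : c ≠ a) : cycDist a (c - 1) + 1 = cycDist a c := by
  have h1 : cycDist a c ≠ 0 := fun h0 => h (cycDist_eq_zero.1 h0).symm
  rw [cycDist] at h1 ⊢
  rw [cycDist, show c - 1 - a = c - a - 1 by abel]
  obtain ⟨m, rfl⟩ := Nat.exists_eq_succ_of_ne_zero (NeZero.ne n)
  rw [Fin.val_sub_one_of_ne_zero (fun h2 => h1 (by rw [h2]; rfl))]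
  omega

theorem cycDist_self_sub_one (a : Fin n) : cycDist a (a - 1) + 1 = n := by
  rw [cycDist, show a - 1 - a = -1 by abel]
  obtain ⟨m, rfl⟩ := Nat.exists_eq_succ_of_ne_zero (NeZero.ne n)
  rw [Fin.coe_neg_one]

theorem cycDist_add_ofNat (a : Fin n) {u : ℕ} (hu : u < n) : cycDist a (a + Fin.ofNat n u) = u := by
  rw [cycDist, add_sub_cancel_left, Fin.val_ofNat, Nat.mod_eq_of_lt hu]

theorem add_ofNat_cycDist (a c : Fin n) : a + Fin.ofNat n (cycDist a c) = c := by
  rw [cycDist, Fin.ofNat_val_eq_self, add_sub_cancel]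

theorem Fin.ofNat_succ_eq (u : ℕ) : Fin.ofNat n (u + 1) = Fin.ofNat n u + 1 := by
  ext
  simp [Fin.val_add, Nat.add_mod]

/-- A domain has a vanishing coefficient in each column and in each row. -/
structure HasZeros (D : GridChain n) : Prop where
  col : ∀ c, ∃ r, D c r = 0
  row : ∀ r, ∃ c, D c r = 0

theorem HasZeros.mono {D E : GridChain n} (h : HasZeros D) (hE : ∀ c r, 0 ≤ E c r)
    (hED : ∀ c r, E c r ≤ D c r) : HasZeros E := by
  refine ⟨fun c => ?_, fun r => ?_⟩
  · obtain ⟨r, hr⟩ := h.col c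
    exact ⟨r, le_antisymm (hr ▸ hED c r) (hE c r)⟩
  · obtain ⟨c, hc⟩ := h.row r
    exact ⟨c, le_antisymm (hc ▸ hED c r) (hE c r)⟩

/-- Otherwise mixed differences at positive boxes are at most `0`. Sweep through the columns,
keeping a height `t` such that the box below it is positive and `F 0 0 + F u t ≤ F u 0`; the height
`H` starts the process. Summing mixed differences carries the inequality to the next column, after
which `t` is lowered to the first zero there, if there is one below. At `u = W` it contradicts `0 <
F 0 0`. -/
theorem exists_staircase_corner (F : ℕ → ℕ → ℤ) (hF : ∀ i j, 0 ≤ F i j) (h0 : 0 < F 0 0)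
    {W H : ℕ} (hW : F W 0 = 0) (hH : F 0 H = 0) :
    ∃ u v, (∀ i ≤ u, ∀ j ≤ v, 0 < F i j) ∧
      F u (v + 1) + F (u + 1) v < F (u + 1) (v + 1) + F u v := by
  by_contra! hcon
  have shrink : ∀ u t, (∀ i < u, ∀ j < t, 0 < F i j) → F 0 0 + F u t ≤ F u 0 →
      ∃ t, (∀ i ≤ u, ∀ j < t, 0 < F i j) ∧ F 0 0 + F u t ≤ F u 0 := by
    intro u t hb ht
    by_cases hz : ∃ s, s < t ∧ F u s = 0
    · classical
      obtain ⟨hs, hs0⟩ := Nat.find_spec hz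
      refine ⟨Nat.find hz, fun i hi j hj => ?_, ?_⟩
      · rcases hi.lt_or_eq with hi | rfl
        · exact hb i hi j (by omega)
        · have h1 := Nat.find_min hz hj
          have h2 := hF i j
          have h3 : F i j ≠ 0 := fun h => h1 ⟨by omega, h⟩
          omega
      · rw [hs0]
        have := hF u t
        omega
    · push Not at hz
      refine ⟨t, fun i hi j hj => ?_, ht⟩
      rcases hi.lt_or_eq with hi | rfl
      · exact hb i hi j hj
      · have := hz j hj
        have := hF i j
        omega
  have inv : ∀ u, ∃ t, (∀ i ≤ u, ∀ j < t, 0 < F i j) ∧ F 0 0 + F u t ≤ F u 0 := by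
    intro u
    induction u with
    | zero => exact shrink 0 H (fun i hi => by omega) (by rw [hH]; omega)
    | succ u ih =>
      obtain ⟨t, hb, ht⟩ := ih
      refine shrink (u + 1) t (fun i hi j hj => hb i (by omega) j hj) ?_
      have hmono : ∀ s ≤ t, F (u + 1) s - F u s ≤ F (u + 1) 0 - F u 0 := by
        intro s
        induction s with
        | zero => intro _; rfl
        | succ s ihs =>
          intro hs
          have h1 := ihs (by omega)
          have h2 := hcon u s fun i hi j hj => hb i hi j (by omega)
          omega
      have := hmono t le_rfl
      omega
  obtain ⟨t, -, ht⟩ := inv W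
  have := hF W t
  omega

variable {D E : GridChain n} {x y z : GridGen n}

/-- The mixed difference of `D` at an intersection point counts `x` positively and `y` negatively.
-/
theorem Connects.apply_eq_of_corner (h : Connects D x y) {i j : Fin n}
    (hc : D (i - 1) j + D i (j - 1) < D (i - 1) (j - 1) + D i j) : x i = j := by
  have h1 := h i j
  simp only [alphaBoundary] at h1
  by_contra hne
  rw [if_neg hne] at h1
  split_ifs at h1 <;> omega

/-- To the upper right of a component in the support of a positive domain there is a point of
the initial generator. -/
theorem Connects.exists_upper_right (h : Connects D x y) (hD : ∀ c r, 0 ≤ D c r)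
    (hz : HasZeros D) {c r : Fin n} (hcr : 0 < D c r) :
    ∃ b, b ≠ c ∧ x b ≠ r ∧
      ∀ c' r', cycDist c c' < cycDist c b → cycDist r r' < cycDist r (x b) → 0 < D c' r' := by
  obtain ⟨r₀, hr₀⟩ := hz.col c
  obtain ⟨c₀, hc₀⟩ := hz.row r
  have he0 : ∀ a : Fin n, a + Fin.ofNat n 0 = a := fun a => by simp
  obtain ⟨u, v, hpos, hcorner⟩ := exists_staircase_corner
    (fun u v => D (c + Fin.ofNat n u) (r + Fin.ofNat n v)) (fun _ _ => hD _ _)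
    (W := cycDist c c₀) (H := cycDist r r₀)
    (by simpa only [he0] using hcr) (by simpa only [he0, add_ofNat_cycDist] using hc₀)
    (by simpa only [he0, add_ofNat_cycDist] using hr₀)
  -- A box that wrapped around would contain the zero of row `r`.
  have hu : u + 1 < n := by
    by_contra hcon
    have := cycDist_lt c c₀
    have := hpos (cycDist c c₀) (by omega) 0 (Nat.zero_le _)
    simp only [he0, add_ofNat_cycDist, hc₀, lt_irrefl] at this
  have hv : v + 1 < n := by
    by_contra hcon
    have := cycDist_lt r r₀
    have := hpos 0 (Nat.zero_le _) (cycDist r r₀) (by omega)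
    simp only [he0, add_ofNat_cycDist, hr₀, lt_irrefl] at this
  have hx : x (c + Fin.ofNat n (u + 1)) = r + Fin.ofNat n (v + 1) := by
    apply h.apply_eq_of_corner
    have h1 : c + Fin.ofNat n (u + 1) - 1 = c + Fin.ofNat n u := by
      rw [Fin.ofNat_succ_eq]; abel
    have h2 : r + Fin.ofNat n (v + 1) - 1 = r + Fin.ofNat n v := by
      rw [Fin.ofNat_succ_eq]; abel
    rw [h1, h2]
    omega
  have hcu := cycDist_add_ofNat c hu
  have hrv := cycDist_add_ofNat r hv
  refine ⟨c + Fin.ofNat n (u + 1), fun hb => ?_, fun hb => ?_, fun c' r' hc' hr' => ?_⟩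
  · rw [hb, cycDist_self] at hcu
    omega
  · rw [hx] at hb
    rw [hb, cycDist_self] at hrv
    omega
  · rw [hx, hrv] at hr'
    rw [hcu] at hc'
    have := hpos (cycDist c c') (by omega) (cycDist r r') (by omega)
    simpa only [add_ofNat_cycDist] using this

/-- To the lower left of a component in the support of a positive domain there is a point of
the initial generator. -/
theorem Connects.exists_lower_left (h : Connects D x y) (hD : ∀ c r, 0 ≤ D c r)
    (hz : HasZeros D) {c r : Fin n} (hcr : 0 < D c r) :
    ∃ b, ∀ c' r', cycDist b c' ≤ cycDist b c → cycDist (x b) r' ≤ cycDist (x b) r →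
      0 < D c' r' := by
  obtain ⟨r₀, hr₀⟩ := hz.col c
  obtain ⟨c₀, hc₀⟩ := hz.row r
  have hback : ∀ a b : Fin n, a - Fin.ofNat n (cycDist b a) = b := by
    intro a b
    rw [cycDist, Fin.ofNat_val_eq_self, sub_sub_cancel]
  have he0 : ∀ a : Fin n, a - Fin.ofNat n 0 = a := fun a => by simp
  obtain ⟨u, v, hpos, hcorner⟩ := exists_staircase_corner
    (fun u v => D (c - Fin.ofNat n u) (r - Fin.ofNat n v)) (fun _ _ => hD _ _)
    (W := cycDist c₀ c) (H := cycDist r₀ r)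
    (by simpa only [he0] using hcr) (by simpa only [he0, hback] using hc₀)
    (by simpa only [he0, hback] using hr₀)
  have hu : u < n := by
    by_contra hcon
    have := cycDist_lt c₀ c
    have := hpos (cycDist c₀ c) (by omega) 0 (Nat.zero_le _)
    simp only [he0, hback, hc₀, lt_irrefl] at this
  have hv : v < n := by
    by_contra hcon
    have := cycDist_lt r₀ r
    have := hpos 0 (Nat.zero_le _) (cycDist r₀ r) (by omega)
    simp only [he0, hback, hr₀, lt_irrefl] at this
  have hx : x (c - Fin.ofNat n u) = r - Fin.ofNat n v := by
    apply h.apply_eq_of_corner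
    have h1 : c - Fin.ofNat n u - 1 = c - Fin.ofNat n (u + 1) := by
      rw [Fin.ofNat_succ_eq]; abel
    have h2 : r - Fin.ofNat n v - 1 = r - Fin.ofNat n (v + 1) := by
      rw [Fin.ofNat_succ_eq]; abel
    rw [h1, h2]
    omega
  have hdist : ∀ (a : Fin n) {u : ℕ}, u < n → cycDist (a - Fin.ofNat n u) a = u := by
    intro a u hu
    rw [cycDist, sub_sub_cancel, Fin.val_ofNat, Nat.mod_eq_of_lt hu]
  have htri : ∀ b c' c : Fin n, cycDist b c' ≤ cycDist b c → cycDist c' c ≤ cycDist b c := by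
    intro b c' c h1
    have := cycDist_lt c' c
    rcases cycDist_add b c' c with h2 | h2 <;> omega
  refine ⟨c - Fin.ofNat n u, fun c' r' hc' hr' => ?_⟩
  rw [hx] at hr'
  have h1 := htri _ _ _ hc'
  have h2 := htri _ _ _ hr'
  rw [hdist c hu] at h1
  rw [hdist r hv] at h2
  simpa only [hback] using hpos _ h1 _ h2

/-- The rectangle whose lower left and upper right corners are the points of `x` on the vertical
circles `a` and `b`. -/
def rect (x : GridGen n) (a b : Fin n) : GridChain n := fun c r =>
  if cycDist a c < cycDist a b ∧ cycDist (x a) r < cycDist (x a) (x b) then 1 else 0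

/-- The rectangle `rect x a b` is nondegenerate, with no points of `x` in its interior. -/
structure EmptyRect (x : GridGen n) (a b : Fin n) : Prop where
  ne : a ≠ b
  empty : ∀ c, c ≠ a → cycDist a c < cycDist a b → cycDist (x a) (x b) < cycDist (x a) (x c)

theorem rect_nonneg (x : GridGen n) (a b c r : Fin n) : 0 ≤ rect x a b c r := by
  unfold rect; split_ifs <;> simp

theorem rect_of_lt {a b c r : Fin n} (h : cycDist a c < cycDist a b)
    (h' : cycDist (x a) r < cycDist (x a) (x b)) : rect x a b c r = 1 := if_pos ⟨h, h'⟩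

theorem rect_of_col {a b c r : Fin n} (h : cycDist a b ≤ cycDist a c) : rect x a b c r = 0 :=
  if_neg fun h' => absurd h'.1 (by omega)

theorem rect_of_row {a b c r : Fin n} (h : cycDist (x a) (x b) ≤ cycDist (x a) r) :
    rect x a b c r = 0 :=
  if_neg fun h' => absurd h'.2 (by omega)

theorem rect_corner {a b : Fin n} (h : a ≠ b) : rect x a b a (x a) = 1 := by
  refine rect_of_lt ?_ ?_ <;> rw [cycDist_self, cycDist_pos]
  · exact h
  · exact fun h' => h (x.injective h')

theorem rect_le_iff {a b : Fin n} (hD : ∀ c r, 0 ≤ D c r) :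
    (∀ c r, rect x a b c r ≤ D c r) ↔
      ∀ c r, cycDist a c < cycDist a b → cycDist (x a) r < cycDist (x a) (x b) → 0 < D c r := by
  refine ⟨fun h c r hc hr => ?_, fun h c r => ?_⟩
  · have := h c r
    rw [rect_of_lt hc hr] at this
    omega
  · unfold rect
    split_ifs with h1
    · exact h c r h1.1 h1.2
    · exact hD c r

/-- The difference of the indicator functions of adjacent components with respect to a cyclic
interval. -/
theorem cycDist_indicator_sub (a b c : Fin n) (h : a ≠ b) :
    (if cycDist a c < cycDist a b then (1 : ℤ) else 0) -
        (if cycDist a (c - 1) < cycDist a b then 1 else 0) =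
      (if c = a then 1 else 0) - (if c = b then 1 else 0) := by
  have h1 := cycDist_lt a b
  have h2 := cycDist_pos.2 h
  by_cases hca : c = a
  · subst hca
    have h3 := cycDist_self_sub_one c
    rw [if_pos (by simpa using h2), if_neg (by omega), if_pos rfl, if_neg h]
  · have h3 := cycDist_sub_one hca
    by_cases hcb : c = b
    · subst hcb
      rw [if_neg (by omega), if_pos (by omega), if_neg hca, if_pos rfl]
    · have h4 : cycDist a c ≠ cycDist a b := fun h => hcb (cycDist_inj h)
      rw [if_neg hca, if_neg hcb]
      by_cases h5 : cycDist a c < cycDist a b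
      · rw [if_pos h5, if_pos (by omega)]; simp
      · rw [if_neg h5, if_neg (by omega)]

theorem rect_eq_mul (x : GridGen n) (a b c r : Fin n) :
    rect x a b c r = (if cycDist a c < cycDist a b then 1 else 0) *
      (if cycDist (x a) r < cycDist (x a) (x b) then 1 else 0) := by
  unfold rect
  split_ifs <;> simp_all

theorem connects_rect {a b : Fin n} (h : a ≠ b) :
    Connects (rect x a b) x (x * Equiv.swap a b) := by
  intro i j
  have h1 := cycDist_indicator_sub a b i h
  have h2 := cycDist_indicator_sub (x a) (x b) j fun h' => h (x.injective h')
  have h3 : ((if (x * Equiv.swap a b) i = j then (1 : ℤ) else 0) - if x i = j then 1 else 0) =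
      -(((if i = a then 1 else 0) - (if i = b then 1 else 0)) *
        ((if j = x a then 1 else 0) - (if j = x b then 1 else 0))) := by
    rw [Equiv.Perm.mul_apply]
    by_cases hia : i = a
    · subst hia
      rw [Equiv.swap_apply_left]
      simp only [if_neg h, if_true, eq_comm (a := j)]
      ring
    · by_cases hib : i = b
      · subst hib
        rw [Equiv.swap_apply_right]
        simp only [if_neg hia, if_true, eq_comm (a := j)]
        ring
      · rw [Equiv.swap_apply_of_ne_of_ne hia hib]
        simp [hia, hib]
  rw [h3, ← h1, ← h2]
  simp only [alphaBoundary, rect_eq_mul]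
  ring

theorem Connects.sub {E : GridChain n} {z : GridGen n} (h : Connects D x y)
    (h' : Connects E x z) : Connects (D - E) z y := by
  intro i j
  have h1 := h i j
  have h2 := h' i j
  simp only [alphaBoundary, Pi.sub_apply] at *
  linarith

/-- Shrinking a nonempty rectangle to an empty one. -/
theorem exists_emptyRect_of_pos (hD : ∀ c r, 0 ≤ D c r) {a b : Fin n} (hab : a ≠ b)
    (hpos : ∀ c r, cycDist a c < cycDist a b → cycDist (x a) r < cycDist (x a) (x b) →
      0 < D c r) :
    ∃ b', EmptyRect x a b' ∧ (∀ c r, rect x a b' c r ≤ D c r) ∧ cycDist a b' ≤ cycDist a b ∧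
      cycDist (x a) (x b') ≤ cycDist (x a) (x b) := by
  induction hk : cycDist a b using Nat.strong_induction_on generalizing b with
  | _ k ih =>
    subst hk
    by_cases he : ∀ c, c ≠ a → cycDist a c < cycDist a b →
        cycDist (x a) (x b) < cycDist (x a) (x c)
    · exact ⟨b, ⟨hab, he⟩, (rect_le_iff hD).2 hpos, le_rfl, le_rfl⟩
    · push Not at he
      obtain ⟨c, hca, hcb, hx⟩ := he
      obtain ⟨b', h1, h2, h3, h4⟩ := ih _ hcb hca.symm
        (fun c' r' hc' hr' => hpos c' r' (hc'.trans hcb) (by omega)) rfl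
      exact ⟨b', h1, h2, by omega, by omega⟩

/-- In a positive domain from `x` there is an empty rectangle starting at any point of `x` whose
upper right component belongs to the domain. -/
theorem Connects.exists_emptyRect (h : Connects D x y) (hD : ∀ c r, 0 ≤ D c r)
    (hz : HasZeros D) {a : Fin n} (ha : 0 < D a (x a)) :
    ∃ b, EmptyRect x a b ∧ ∀ c r, rect x a b c r ≤ D c r := by
  obtain ⟨b, hb, -, hpos⟩ := h.exists_upper_right hD hz ha
  obtain ⟨b', h1, h2, -⟩ := exists_emptyRect_of_pos hD hb.symm hpos
  exact ⟨b', h1, h2⟩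

theorem Connects.exists_emptyRect_of_ne_zero (h : Connects D x y) (hD : ∀ c r, 0 ≤ D c r)
    (hz : HasZeros D) (hne : D ≠ 0) :
    ∃ a b, EmptyRect x a b ∧ ∀ c r, rect x a b c r ≤ D c r := by
  have h1 : ∃ c r, D c r ≠ 0 := by
    by_contra! hcon
    exact hne (funext fun c => funext fun r => hcon c r)
  obtain ⟨c, r, hcr⟩ := h1
  obtain ⟨a, ha⟩ := h.exists_lower_left hD hz (lt_of_le_of_ne (hD c r) hcr.symm)
  obtain ⟨b, hb⟩ := h.exists_emptyRect hD hz (ha a (x a) (by simp) (by simp))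
  exact ⟨a, b, hb⟩

/-! ### The edge labels -/

/-- The label of the rectangle with left side `a` and right side `b`. -/
def rectLabel (a b : Fin n) : ℕ := a * (3 * n) + if a < b then b.val else 2 * n - b

theorem rectLabel_lt_iff {a b a' b' : Fin n} : rectLabel a b < rectLabel a' b' ↔
    a < a' ∨ a = a' ∧ (if a < b then b.val else 2 * n - b) <
      (if a' < b' then b'.val else 2 * n - b') := by
  -- The factor `3 * n` dominates the second entry, so labels are lexicographic. Wrapped right sides
  -- get more than `n`, hence come after all unwrapped ones, and in reverse order.
  have hb : (if a < b then b.val else 2 * n - b) < 3 * n := by split_ifs <;> omega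
  have hb' : (if a' < b' then b'.val else 2 * n - b') < 3 * n := by split_ifs <;> omega
  unfold rectLabel
  rcases lt_trichotomy a a' with h | h | h
  · have h1 : (a.val + 1) * (3 * n) ≤ a'.val * (3 * n) := Nat.mul_le_mul_right _ h
    rw [Nat.add_mul] at h1
    exact ⟨fun _ => Or.inl h, fun _ => by omega⟩
  · subst h
    simp
  · have h1 : (a'.val + 1) * (3 * n) ≤ a.val * (3 * n) := Nat.mul_le_mul_right _ h
    rw [Nat.add_mul] at h1
    refine ⟨fun _ => by omega, fun h2 => ?_⟩
    rcases h2 with h2 | h2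
    · exact absurd h2 h.asymm
    · exact absurd h2.1 h.ne'

theorem rectLabel_lt_of_left {a b a' b' : Fin n} (h : a < a') : rectLabel a b < rectLabel a' b' :=
  rectLabel_lt_iff.2 (Or.inl h)

/-- For rectangles with the same left side `a`, the right sides are ordered as
`a + 1, …, n - 1, a - 1, …, 0`. -/
theorem rectLabel_lt_iff_right {a b b' : Fin n} (hb : a ≠ b) (hb' : a ≠ b') :
    rectLabel a b < rectLabel a b' ↔
      (cycDist a b < cycDist a b' ∧ a < b) ∨ (cycDist a b' < cycDist a b ∧ b' < a ∧ b < a) ∨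
      (a < b ∧ b' < a) := by
  rw [rectLabel_lt_iff]
  have h1 := cycDist_spec a b
  have h2 := cycDist_spec a b'
  have h3 := Fin.val_ne_of_ne hb
  have h4 := Fin.val_ne_of_ne hb'
  simp only [lt_irrefl, true_and, false_or, Fin.lt_def]
  split_ifs <;> omega

theorem rectLabel_inj {a b a' b' : Fin n} (hb : a ≠ b) (hb' : a' ≠ b')
    (h : rectLabel a b = rectLabel a' b') : a = a' ∧ b = b' := by
  have ha : a = a' := by
    rcases lt_trichotomy a a' with h1 | h1 | h1
    · exact absurd h (rectLabel_lt_of_left h1).ne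
    · exact h1
    · exact absurd h (rectLabel_lt_of_left h1).ne'
  subst ha
  refine ⟨rfl, ?_⟩
  unfold rectLabel at h
  have h1 := Fin.val_ne_of_ne hb
  have h2 := Fin.val_ne_of_ne hb'
  rw [Fin.ext_iff]
  simp only [Fin.lt_def] at h
  split_ifs at h <;> omega

/-! ### Comparing labels of rectangles -/

theorem mul_swap_of_ne {a b c : Fin n} (ha : c ≠ a) (hb : c ≠ b) :
    (x * Equiv.swap a b) c = x c := by
  rw [Equiv.Perm.mul_apply, Equiv.swap_apply_of_ne_of_ne ha hb]

theorem mul_swap_left (x : GridGen n) (a b : Fin n) : (x * Equiv.swap a b) a = x b := by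
  rw [Equiv.Perm.mul_apply, Equiv.swap_apply_left]

theorem mul_swap_right (x : GridGen n) (a b : Fin n) : (x * Equiv.swap a b) b = x a := by
  rw [Equiv.Perm.mul_apply, Equiv.swap_apply_right]

/-- There is an empty rectangle in `D` from `x` with a label less than that of `a`, `b`. -/
def HasSmallerRect (D : GridChain n) (x : GridGen n) (a b : Fin n) : Prop :=
  ∃ i j, EmptyRect x i j ∧ (∀ c r, rect x i j c r ≤ D c r) ∧ rectLabel i j < rectLabel a b

theorem Connects.hasSmallerRect_of_left (h : Connects D x y) (hD : ∀ c r, 0 ≤ D c r)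
    (hz : HasZeros D) {a b c : Fin n} (hca : c < a) (hc : 0 < D c (x c)) :
    HasSmallerRect D x a b := by
  obtain ⟨j, h1, h2⟩ := h.exists_emptyRect hD hz hc
  exact ⟨c, j, h1, h2, rectLabel_lt_of_left hca⟩

/-- Shrinking to an empty rectangle may raise the label, but only if its new right side `c'` has
wrapped past the cut, so that `c' < a`. Then the point of `x` on `c'` lies inside the original
rectangle, and a rectangle starting there has a smaller left side. -/
theorem Connects.hasSmallerRect_of_right (h : Connects D x y) (hD : ∀ c r, 0 ≤ D c r)
    (hz : HasZeros D) {a b c : Fin n} (hab : a ≠ b) (hca : a ≠ c)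
    (hl : rectLabel a c < rectLabel a b)
    (hpos : ∀ c' r, cycDist a c' < cycDist a c → cycDist (x a) r < cycDist (x a) (x c) →
      0 < D c' r) : HasSmallerRect D x a b := by
  obtain ⟨c', h1, h2, h3, h4⟩ := exists_emptyRect_of_pos hD hca hpos
  by_cases hcc : c' = c
  · exact ⟨a, c', h1, h2, hcc ▸ hl⟩
  have h3' : cycDist a c' < cycDist a c :=
    lt_of_le_of_ne h3 fun h5 => hcc (cycDist_inj h5)
  have h4' : cycDist (x a) (x c') < cycDist (x a) (x c) :=
    lt_of_le_of_ne h4 fun h5 => hcc (x.injective (cycDist_inj h5))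
  by_cases hl' : rectLabel a c' < rectLabel a b
  · exact ⟨a, c', h1, h2, hl'⟩
  · refine h.hasSmallerRect_of_left hD hz (c := c') ?_ (hpos c' (x c') h3' h4')
    rw [rectLabel_lt_iff_right hca hab] at hl
    rw [rectLabel_lt_iff_right h1.ne hab] at hl'
    have h5 := cycDist_spec a c
    have h6 := cycDist_spec a c'
    have h7 := cycDist_spec a b
    have h8 := h1.ne
    rw [Ne, Fin.ext_iff] at h8
    simp only [Fin.lt_def] at *
    omega

theorem EmptyRect.rect_apply_self {a b c : Fin n} (h : EmptyRect x a b) (hca : c ≠ a) :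
    rect x a b c (x c) = 0 := by
  rcases lt_or_ge (cycDist a c) (cycDist a b) with h1 | h1
  · exact rect_of_row (h.empty c hca h1).le
  · exact rect_of_col h1

/-- The crossing case of the comparison of two rectangles in a domain. -/
theorem Connects.hasSmallerRect_of_adjacent (h : Connects D x y) (hD : ∀ c r, 0 ≤ D c r)
    (hz : HasZeros D) {a b : Fin n} (hba : b < a)
    (hempty : ∀ c, a < c → cycDist (x b) (x a) < cycDist (x b) (x c))
    (hb : 0 < D b (x a)) : HasSmallerRect D x a b := by
  by_contra hno
  have hleft : ∀ c, c < a → ¬ 0 < D c (x c) := fun c hca hc =>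
    hno (h.hasSmallerRect_of_left hD hz hca hc)
  have hright : ∀ c, c ≠ a → rectLabel a c < rectLabel a b →
      ¬ ∀ c' r, cycDist a c' < cycDist a c → cycDist (x a) r < cycDist (x a) (x c) →
      0 < D c' r := fun c hca hl hpos =>
    hno (h.hasSmallerRect_of_right hD hz hba.ne' hca.symm hl hpos)
  have hDb : D b (x b) = 0 := le_antisymm (not_lt.1 (hleft b hba)) (hD _ _)
  have hxab : x a ≠ x b := fun h' => hba.ne' (x.injective h')
  -- The point to the lower left of `(b, x a)` must be the one on `a`: a left side below `a` is
  -- excluded, and from one beyond `a` the box would sweep over the zero at `(b, x b)`.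
  have hrow : ∀ k, cycDist a k ≤ cycDist a b → 0 < D k (x a) := by
    obtain ⟨c, hc⟩ := h.exists_lower_left hD hz hb
    have hcc := hc c (x c) (by simp) (by simp)
    rcases lt_trichotomy c a with h1 | rfl | h1
    · exact absurd hcc (hleft c h1)
    · exact fun k hk => hc k _ hk (by simp)
    · have h2 := hempty c h1
      have h3 := hc b (x b) (by simp) (by
        have := cycDist_spec (x b) (x a)
        have := cycDist_spec (x b) (x c)
        have := cycDist_spec (x c) (x a)
        have := cycDist_spec (x c) (x b)
        have := cycDist_lt (x c) (x b)
        have := cycDist_lt (x c) (x a)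
        omega)
      omega
  -- `T` is the first row above `x a` in which some column from `a` to `b` has a zero; everything in
  -- these columns below `T` is positive.
  obtain ⟨T, k, hk, hkT, hbelow⟩ : ∃ T k, cycDist a k ≤ cycDist a b ∧ D k T = 0 ∧
      ∀ k r, cycDist a k ≤ cycDist a b → cycDist (x a) r < cycDist (x a) T → 0 < D k r := by
    classical
    have hex : ∃ v, ∃ T k, cycDist (x a) T = v ∧ cycDist a k ≤ cycDist a b ∧ D k T = 0 :=
      ⟨_, x b, b, rfl, le_rfl, hDb⟩
    obtain ⟨T, k, h1, h2, h3⟩ := Nat.find_spec hex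
    refine ⟨T, k, h2, h3, fun k' r hk' hr => ?_⟩
    by_contra hcon
    exact Nat.find_min hex (h1 ▸ hr) ⟨r, k', rfl, hk', le_antisymm (not_lt.1 hcon) (hD _ _)⟩
  have hTa : T ≠ x a := by
    rintro rfl
    have := hrow k hk
    omega
  have hTb : cycDist (x a) T ≤ cycDist (x a) (x b) := by
    by_contra hcon
    have := hbelow b (x b) le_rfl (by omega)
    omega
  -- If `D b T` is positive, the point to its lower left is on some `c` beyond `a`, at height at
  -- most `T`; the rectangle from `a` to `c` is unwrapped. If it vanishes, the point to the upper
  -- right of `(b, x a)` extends the positive block below `T` past `b`.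
  rcases lt_or_ge 0 (D b T) with hbT | hbT
  · obtain ⟨c, hc⟩ := h.exists_lower_left hD hz hbT
    have hcc := hc c (x c) (by simp) (by simp)
    rcases lt_trichotomy c a with h1 | rfl | h1
    · exact absurd hcc (hleft c h1)
    · have := hc k T hk le_rfl
      omega
    · have h2 := hempty c h1
      have hxca : x c ≠ x a := fun h' => h1.ne' (x.injective h')
      have h4 : ¬ cycDist (x c) (x b) ≤ cycDist (x c) T := fun h5 => by
        have := hc b (x b) (by simp) h5
        omega
      refine hright c h1.ne' ?_ fun c' r hc' hr => hbelow c' r ?_ ?_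
      · rw [rectLabel_lt_iff_right h1.ne hba.ne']
        exact Or.inr (Or.inr ⟨h1, hba⟩)
      · have := cycDist_spec a c
        have := cycDist_spec a b
        have := c.isLt
        have := Fin.lt_def.1 h1
        have := Fin.lt_def.1 hba
        omega
      · have := cycDist_spec (x b) (x a)
        have := cycDist_spec (x a) (x b)
        have := cycDist_spec (x b) (x c)
        have := cycDist_spec (x c) (x b)
        have := cycDist_spec (x c) T
        have := cycDist_spec (x a) T
        have := cycDist_spec (x a) (x c)
        rw [Ne, Fin.ext_iff] at *
        omega
  · obtain ⟨c, hcb, hxc, hpos⟩ := h.exists_upper_right hD hz hb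
    have hbT' : D b T = 0 := le_antisymm hbT (hD _ _)
    have h1 : cycDist (x a) (x c) ≤ cycDist (x a) T := by
      by_contra hcon
      have := hpos b T (by simpa [cycDist_pos] using hcb.symm) (by omega)
      omega
    have hca : c ≠ a := by
      rintro rfl
      exact hxc rfl
    have hadd := cycDist_add a b c
    rcases lt_or_ge (cycDist a c) (cycDist a b) with h2 | h2
    -- If `c` came back between `a` and `b`, row `x a` would be positive all around the torus.
    · obtain ⟨k', hk'⟩ := hz.row (x a)
      rcases le_or_gt (cycDist a k') (cycDist a b) with h3 | h3
      · have := hrow k' h3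
        omega
      · have := hpos k' (x a) (by
          have := cycDist_add a b k'
          have := cycDist_lt a k'
          have := cycDist_lt b k'
          have := cycDist_lt b c
          omega) (by simpa [cycDist_pos] using hxc.symm)
        omega
    · have h2' : cycDist a b ≠ cycDist a c := fun h' => hcb (cycDist_inj h').symm
      refine hright c hca ?_ fun c' r hc' hr => ?_
      · rw [rectLabel_lt_iff_right hca.symm hba.ne']
        rcases lt_or_gt_of_ne hca with h3 | h3
        · exact Or.inr (Or.inl ⟨by omega, hba, h3⟩)
        · exact Or.inr (Or.inr ⟨h3, hba⟩)
      · rcases le_or_gt (cycDist a c') (cycDist a b) with h3 | h3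
        · exact hbelow c' r h3 (by omega)
        · refine hpos c' r ?_ hr
          have := cycDist_add a b c'
          have := cycDist_lt a c'
          have := cycDist_lt b c'
          have := cycDist_lt b c
          omega

/-- If a domain contains an empty rectangle with a smaller label than another one, then the same
holds after removing the latter. -/
theorem Connects.hasSmallerRect_sub (h : Connects D x y) (hD : ∀ c r, 0 ≤ D c r)
    (hz : HasZeros D) {a b i j : Fin n} (hab : EmptyRect x a b)
    (habD : ∀ c r, rect x a b c r ≤ D c r) (hij : EmptyRect x i j)
    (hijD : ∀ c r, rect x i j c r ≤ D c r) (hl : rectLabel i j < rectLabel a b) :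
    HasSmallerRect (D - rect x a b) (x * Equiv.swap a b) a b := by
  have h' := h.sub (connects_rect hab.ne)
  have hD' : ∀ c r, 0 ≤ (D - rect x a b) c r := fun c r => sub_nonneg.2 (habD c r)
  have hz' : HasZeros (D - rect x a b) :=
    hz.mono hD' fun c r => sub_le_self _ (rect_nonneg x a b c r)
  have hpos := (rect_le_iff hD).1 hijD
  have hsub : ∀ c r, 0 < D c r → rect x a b c r = 0 → 0 < (D - rect x a b) c r := by
    intro c r h1 h2
    simpa [h2] using h1
  have hxab : x a ≠ x b := fun h' => hab.ne (x.injective h')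
  have hijc : 0 < D i (x i) := by
    have := hijD i (x i)
    rw [rect_corner hij.ne] at this
    omega
  rcases rectLabel_lt_iff.1 hl with hia | ⟨rfl, -⟩
  -- For `i ≠ b` the point on `i` is untouched, and emptiness keeps its component outside the
  -- removed rectangle. For `i = b` the point has moved to the bottom of that rectangle, which is
  -- the crossing case.
  · by_cases hib : i = b
    · subst hib
      by_cases hD0 : 0 < (D - rect x a i) i (x a)
      · refine h'.hasSmallerRect_of_left hD' hz' hia ?_
        rwa [mul_swap_right]
      · refine h'.hasSmallerRect_of_adjacent hD' hz' hia (fun c hc => ?_) ?_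
        · rw [mul_swap_right, mul_swap_left, mul_swap_of_ne hc.ne' (hia.trans hc).ne']
          refine hab.empty c hc.ne' ?_
          have := cycDist_spec a c
          have := cycDist_spec a i
          have := c.isLt
          have := Fin.lt_def.1 hc
          have := Fin.lt_def.1 hia
          omega
        · rw [mul_swap_left]
          exact hsub _ _ hijc (rect_of_col le_rfl)
    · refine h'.hasSmallerRect_of_left hD' hz' hia ?_
      rw [mul_swap_of_ne hia.ne hib]
      exact hsub _ _ hijc (hab.rect_apply_self hia.ne)
  · have hbj : j ≠ b := by
      rintro rfl
      exact lt_irrefl _ hl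
    have hbj' : cycDist i j ≠ cycDist i b := fun h' => hbj (cycDist_inj h')
    rcases lt_or_gt_of_ne hbj' with h1 | h1
    -- The narrower rectangle is also taller, and its part above the removed one survives.
    · have h2 := hab.empty j hij.ne.symm h1
      refine h'.hasSmallerRect_of_right hD' hz' hab.ne hij.ne hl fun c r hc hr => ?_
      rw [mul_swap_left, mul_swap_of_ne hij.ne.symm hbj] at hr
      have hx1 : x i ≠ x j := fun h' => hij.ne (x.injective h')
      have hx2 : x j ≠ x b := fun h' => hbj (x.injective h')
      refine hsub _ _ (hpos c r hc ?_) (rect_of_row ?_)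
      · have := cycDist_add (x i) (x b) (x j)
        have := cycDist_add (x i) (x b) r
        have := cycDist_lt (x b) (x j)
        have := cycDist_lt (x i) r
        omega
      · have := cycDist_add (x i) (x b) (x j)
        have := cycDist_add (x i) (x b) r
        have := cycDist_lt (x b) (x j)
        have := cycDist_lt (x i) (x j)
        have := cycDist_lt (x i) r
        omega
    -- The wider rectangle continues to the right of the removed one, past the new point `(b, x i)`;
    -- the order of the labels forces `b` to be wrapped.
    · have h2 := hij.empty b hab.ne.symm h1
      have h3 : b < i := by
        rw [rectLabel_lt_iff_right hij.ne hab.ne] at hl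
        rcases hl with hl | hl | hl
        · omega
        · exact hl.2.1
        · exact hl.2
      refine h'.hasSmallerRect_of_left hD' hz' h3 ?_
      rw [mul_swap_right]
      exact hsub _ _ (hpos b (x i) h1 (by simpa [cycDist_pos] using fun h' => hij.ne (x.injective h')))
        (rect_of_col le_rfl)

/-- If the labels of two consecutive empty rectangles decrease, then their sum contains an empty
rectangle with a smaller label than the first one. -/
theorem Connects.hasSmallerRect_add (h : Connects D x y) (hz : HasZeros D) {a b a' b' : Fin n}
    (hab : EmptyRect x a b) (hab' : EmptyRect (x * Equiv.swap a b) a' b')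
    (hDe : D = rect x a b + rect (x * Equiv.swap a b) a' b')
    (hl : rectLabel a' b' < rectLabel a b) : HasSmallerRect D x a b := by
  set z := x * Equiv.swap a b with hzdef
  have hD : ∀ c r, 0 ≤ D c r := fun c r => by
    rw [hDe]
    exact add_nonneg (rect_nonneg _ _ _ _ _) (rect_nonneg _ _ _ _ _)
  have hD1 : ∀ c r, rect x a b c r ≤ D c r := fun c r => by
    rw [hDe]
    exact le_add_of_nonneg_right (rect_nonneg _ _ _ _ _)
  have hD2 : ∀ c r, rect z a' b' c r ≤ D c r := fun c r => by
    rw [hDe]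
    exact le_add_of_nonneg_left (rect_nonneg _ _ _ _ _)
  have hpos1 := (rect_le_iff hD).1 hD1
  have hpos2 := (rect_le_iff hD).1 hD2
  have hza : z a = x b := mul_swap_left x a b
  have hzb : z b = x a := mul_swap_right x a b
  have hz_ne : ∀ c, c ≠ a → c ≠ b → z c = x c := fun c h1 h2 => mul_swap_of_ne h1 h2
  have hxab : x a ≠ x b := fun h' => hab.ne (x.injective h')
  rcases rectLabel_lt_iff.1 hl with hlt | ⟨rfl, -⟩
  · by_cases hb : a' = b
    · subst hb
      rw [hzb] at hpos2
      by_cases h0 : 0 < D a' (x a')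
      · exact h.hasSmallerRect_of_left hD hz hlt h0
      have h1 : cycDist (x a) (z b') ≤ cycDist (x a) (x a') := by
        by_contra hcon
        exact h0 (hpos2 a' (x a') (by simpa [cycDist_pos] using hab'.ne) (by omega))
      have hxz : x a ≠ z b' := fun h' => hab'.ne (z.injective (hzb.trans h'))
      -- Otherwise the two rectangles, side by side on the row `x a`, would fill it completely.
      have hwrap : cycDist a' b' < cycDist a' a := by
        by_contra hcon
        obtain ⟨k, hk⟩ := hz.row (x a)
        rcases lt_or_ge (cycDist a k) (cycDist a a') with h3 | h3
        · have := hpos1 k (x a) h3 (by simpa [cycDist_pos] using hxab)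
          omega
        · have := hpos2 k (x a) (by
            have := cycDist_add a a' k
            have := cycDist_add a a' a
            have := cycDist_self a
            have := cycDist_pos.2 hab.ne
            have := cycDist_lt a k
            have := cycDist_lt a' k
            have := cycDist_lt a' a
            have := cycDist_lt a a'
            omega) (by simpa [cycDist_pos] using hxz)
          omega
      have hb'a : b' ≠ a := by
        rintro rfl
        omega
      have hzb' : z b' = x b' := hz_ne b' hb'a hab'.ne.symm
      rw [hzb'] at h1 hxz hpos2
      have h1' : cycDist (x a) (x b') ≠ cycDist (x a) (x a') := fun h' =>
        hab'.ne (x.injective (cycDist_inj h')).symm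
      have hb'lt : b' < a ∧ cycDist a a' < cycDist a b' := by
        have := cycDist_spec a' b'
        have := cycDist_spec a' a
        have := cycDist_spec a a'
        have := cycDist_spec a b'
        have := hab'.ne
        have := b'.isLt
        rw [Ne, Fin.ext_iff] at *
        rw [Fin.lt_def] at *
        omega
      have hcase : ∀ c, ¬ cycDist a c < cycDist a a' → cycDist a c < cycDist a b' →
          cycDist a' c < cycDist a' b' := by
        intro c h3 h4
        have := cycDist_add a a' c
        have := cycDist_add a a' b'
        have := cycDist_lt a' c
        have := cycDist_lt a' b'
        have := cycDist_lt a b'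
        omega
      -- The second rectangle and the lower part of the first form one rectangle. It reaches further
      -- past the cut than the first, so its label is smaller.
      refine ⟨a, b', ⟨hb'a.symm, fun c hca hc => ?_⟩, (rect_le_iff hD).2 fun c r hc hr => ?_, ?_⟩
      · by_cases h3 : cycDist a c < cycDist a a'
        · have := hab.empty c hca h3
          omega
        · by_cases h4 : c = a'
          · subst h4
            omega
          · have h5 := hab'.empty c h4 (hcase c h3 hc)
            rwa [hzb, hzb', hz_ne c hca h4] at h5
      · by_cases h3 : cycDist a c < cycDist a a'
        · exact hpos1 c r h3 (by omega)
        · exact hpos2 c r (hcase c h3 hc) hr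
      · rw [rectLabel_lt_iff_right hb'a.symm hab.ne]
        exact Or.inr (Or.inl ⟨hb'lt.2, hlt, hb'lt.1⟩)
    · refine h.hasSmallerRect_of_left hD hz hlt ?_
      have := hD2 a' (z a')
      rw [rect_corner hab'.ne, hz_ne a' hlt.ne hb] at this
      omega
  · have hbb : b' ≠ b := by
      rintro rfl
      exact lt_irrefl _ hl
    have hzb' : z b' = x b' := hz_ne b' hab'.ne.symm hbb
    have hbb' : cycDist a' b' ≠ cycDist a' b := fun h' => hbb (cycDist_inj h')
    have hxb' : x b ≠ x b' := fun h' => hbb (x.injective h').symm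
    rw [hza, hzb'] at hpos2
    rcases lt_or_gt_of_ne hbb' with h1 | h1
    -- The second rectangle stands on the first and is narrower; it is prolonged downwards to the
    -- row `x a'`.
    · have h2 := hab.empty b' hab'.ne.symm h1
      have hrow : ∀ r, cycDist (x a') r < cycDist (x a') (x b') →
          ¬ cycDist (x a') r < cycDist (x a') (x b) →
          cycDist (x b) r < cycDist (x b) (x b') := by
        intro r h3 h4
        have := cycDist_add (x a') (x b) r
        have := cycDist_add (x a') (x b) (x b')
        have := cycDist_lt (x b) r
        have := cycDist_lt (x b) (x b')
        have := cycDist_lt (x a') (x b')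
        omega
      refine ⟨a', b', ⟨hab'.ne, fun c hca hc => ?_⟩, (rect_le_iff hD).2 fun c r hc hr => ?_, hl⟩
      · have h3 := hab.empty c hca (by omega)
        have hcb : c ≠ b := by
          rintro rfl
          omega
        have h4 := hab'.empty c hca hc
        rw [hza, hzb', hz_ne c hca hcb] at h4
        by_contra h5
        have h6 : c ≠ b' := by
          rintro rfl
          omega
        have h6' : cycDist (x a') (x c) ≠ cycDist (x a') (x b') := fun h' =>
          h6 (x.injective (cycDist_inj h'))
        have := hrow (x c) (by omega) (by omega)
        omega
      · by_cases h3 : cycDist (x a') r < cycDist (x a') (x b)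
        · exact hpos1 c r (by omega) h3
        · exact hpos2 c r hc (hrow r hr h3)
    · have h3 : b < a' := by
        rw [rectLabel_lt_iff_right hab'.ne hab.ne] at hl
        rcases hl with hl | hl | hl
        · omega
        · exact hl.2.1
        · exact hl.2
      exact h.hasSmallerRect_of_left hD hz h3
        (hpos2 b (x b) h1 (by simpa [cycDist_pos] using hxb'))

/-! ### The index of a domain -/

/-- The sum of the coefficients of the four components around an intersection point. -/
def cornerSum (D : GridChain n) (i j : Fin n) : ℤ :=
  D i j + D (i - 1) j + D i (j - 1) + D (i - 1) (j - 1)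

/-- Four times the index of a domain from `x` to `y`. -/
def domainIndex (D : GridChain n) (x y : GridGen n) : ℤ :=
  ∑ i, cornerSum D i (x i) + ∑ i, cornerSum D i (y i)

theorem domainIndex_nonneg (hD : ∀ c r, 0 ≤ D c r) : 0 ≤ domainIndex D x y := by
  have h : ∀ i j, 0 ≤ cornerSum D i j := fun i j => by
    have := hD i j
    have := hD (i - 1) j
    have := hD i (j - 1)
    have := hD (i - 1) (j - 1)
    unfold cornerSum
    omega
  exact add_nonneg (Finset.sum_nonneg fun i _ => h _ _) (Finset.sum_nonneg fun i _ => h _ _)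

theorem cornerSum_add (i j : Fin n) :
    cornerSum (D + E) i j = cornerSum D i j + cornerSum E i j := by
  simp only [cornerSum, Pi.add_apply]
  ring

theorem sum_shift_col (F : Fin n → Fin n → ℤ) : ∑ i, ∑ j, F (i - 1) j = ∑ i, ∑ j, F i j :=
  (Equiv.subRight (1 : Fin n)).sum_comp fun i => ∑ j, F i j

theorem sum_shift_row (F : Fin n → Fin n → ℤ) : ∑ i, ∑ j, F i (j - 1) = ∑ i, ∑ j, F i j :=
  Finset.sum_congr rfl fun i _ => (Equiv.subRight (1 : Fin n)).sum_comp fun j => F i j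

theorem Connects.sum_cornerSum (h : Connects D x y) (E : GridChain n) :
    ∑ i, cornerSum E i (y i) - ∑ i, cornerSum E i (x i) =
      ∑ i, ∑ j, (alphaBoundary D (i - 1) j - alphaBoundary D i j) * cornerSum E i j := by
  rw [← Finset.sum_sub_distrib]
  refine Finset.sum_congr rfl fun i _ => ?_
  simp only [h i, sub_mul, ite_mul, one_mul, zero_mul, Finset.sum_sub_distrib,
    Finset.sum_ite_eq, Finset.mem_univ, if_true]

/-- The two sides differ by sums that telescope around the torus. This symmetry is what makes the
index additive: the two mixed terms in the index of a sum cancel. -/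
theorem sum_boundary_mul_cornerSum_comm (D E : GridChain n) :
    ∑ i, ∑ j, (alphaBoundary D (i - 1) j - alphaBoundary D i j) * cornerSum E i j =
      ∑ i, ∑ j, (alphaBoundary E (i - 1) j - alphaBoundary E i j) * cornerSum D i j := by
  have h1 := sum_shift_row fun i j => D (i - 1) j * E i j
  have h2 := sum_shift_col fun i j => D i j * E i (j - 1)
  have h3 := sum_shift_col fun i j => D i (j - 1) * E i j
  have h4 := sum_shift_row fun i j => D i j * E (i - 1) j
  have key : ∀ i j, (alphaBoundary D (i - 1) j - alphaBoundary D i j) * cornerSum E i j =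
      (alphaBoundary E (i - 1) j - alphaBoundary E i j) * cornerSum D i j +
      2 * ((D (i - 1) j * E i j - D (i - 1) (j - 1) * E i (j - 1)) +
        (D (i - 1) j * E (i - 1) (j - 1) - D i j * E i (j - 1)) +
        (D i (j - 1) * E i j - D (i - 1) (j - 1) * E (i - 1) j) +
        (D i (j - 1) * E (i - 1) (j - 1) - D i j * E (i - 1) j)) := by
    intro i j
    simp only [alphaBoundary, cornerSum]
    ring
  simp only [key, Finset.sum_add_distrib, ← Finset.mul_sum, Finset.sum_sub_distrib]
  linarith

theorem Connects.domainIndex_add (h : Connects D x y) (h' : Connects E y z) :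
    domainIndex (D + E) x z = domainIndex D x y + domainIndex E y z := by
  have h1 := h.sum_cornerSum E
  have h2 := h'.sum_cornerSum D
  rw [sum_boundary_mul_cornerSum_comm] at h1
  simp only [domainIndex, cornerSum_add, Finset.sum_add_distrib]
  linarith

theorem Connects.periodic (h : Connects D x x) (i j : Fin n) : D i j = D i 0 + D 0 j - D 0 0 := by
  have h1 : ∀ i j, D i j - D i (j - 1) = D 0 j - D 0 (j - 1) := fun i j =>
    fin_cyclic_const (fun i => D i j - D i (j - 1))
      (fun i => by have := h i j; simp only [alphaBoundary] at this; linarith) i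
  have h2 : D i j - D 0 j = D i 0 - D 0 0 :=
    fin_cyclic_const (fun j => D i j - D 0 j) (fun j => by linarith [h1 i j]) j
  linarith

/-- The sum of the coefficients of a periodic domain along a permutation does not depend on the
permutation. -/
theorem Connects.sum_perm (h : Connects D x x) (σ τ : Equiv.Perm (Fin n)) :
    ∑ i, D i (σ i) = ∑ i, D i (τ i) := by
  have h3 : ∀ τ : Equiv.Perm (Fin n),
      ∑ i, D i (τ i) = ∑ i, (D i 0 - D 0 0) + ∑ i, D 0 i := by
    intro τ
    rw [← Equiv.sum_comp τ (fun i => D 0 i), ← Finset.sum_add_distrib]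
    exact Finset.sum_congr rfl fun i _ => by linarith [h.periodic i (τ i)]
  rw [h3, h3]

/-- The four components around the points of `τ` run along four permutations, namely `τ` shifted by
at most one in each direction. -/
theorem Connects.sum_cornerSum_eq_zero (h : Connects D x x) (σ τ : Equiv.Perm (Fin n))
    (hσ : ∑ i, D i (σ i) = 0) : ∑ i, cornerSum D i (τ i) = 0 := by
  have h1 : ∀ τ : Equiv.Perm (Fin n), ∑ i, D i (τ i) = 0 := fun τ => (h.sum_perm τ σ).trans hσ
  have h3 := h1 (τ.trans (Equiv.subRight 1))
  have h4 := h1 ((Equiv.addRight 1).trans τ)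
  have h5 := h1 (((Equiv.addRight 1).trans τ).trans (Equiv.subRight 1))
  rw [← (Equiv.subRight (1 : Fin n)).sum_comp] at h4 h5
  simp only [Equiv.trans_apply, Equiv.subRight_apply, Equiv.coe_addRight, sub_add_cancel]
    at h3 h4 h5
  simp only [cornerSum, Finset.sum_add_distrib, h1 τ, h3, h4, h5, add_zero]

/-- The difference of the domains is periodic, and its sum along one permutation controls its index.
-/
theorem Connects.domainIndex_eq (h : Connects D x y) (h' : Connects E x y)
    (σ : Equiv.Perm (Fin n)) (hσ : ∀ i, D i (σ i) = E i (σ i)) :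
    domainIndex D x y = domainIndex E x y := by
  have hp : Connects (D - E) y y := h.sub h'
  have h0 : ∑ i, (D - E) i (σ i) = 0 := Finset.sum_eq_zero fun i _ => by simp [hσ i]
  have h1 := hp.sum_cornerSum_eq_zero σ x h0
  have h2 := hp.sum_cornerSum_eq_zero σ y h0
  have h3 : D = (D - E) + E := by simp
  rw [domainIndex, h3]
  simp only [cornerSum_add, Finset.sum_add_distrib, h1, h2, zero_add]
  rfl

theorem cornerSum_rect (x : GridGen n) (a b i j : Fin n) : cornerSum (rect x a b) i j =
    ((if cycDist a i < cycDist a b then 1 else 0) +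
      (if cycDist a (i - 1) < cycDist a b then 1 else 0)) *
    ((if cycDist (x a) j < cycDist (x a) (x b) then 1 else 0) +
      (if cycDist (x a) (j - 1) < cycDist (x a) (x b) then 1 else 0)) := by
  simp only [cornerSum, rect_eq_mul]
  ring

theorem cycDist_indicator_add_left {a b : Fin n} (h : a ≠ b) :
    ((if cycDist a a < cycDist a b then 1 else 0) +
      (if cycDist a (a - 1) < cycDist a b then 1 else 0) : ℤ) = 1 := by
  have h1 := cycDist_lt a b
  have h2 := cycDist_pos.2 h
  have h3 := cycDist_self_sub_one a
  rw [if_pos (by simpa using h2), if_neg (by omega), add_zero]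

theorem cycDist_indicator_add_right {a b : Fin n} (h : a ≠ b) :
    ((if cycDist a b < cycDist a b then 1 else 0) +
      (if cycDist a (b - 1) < cycDist a b then 1 else 0) : ℤ) = 1 := by
  have h3 := cycDist_sub_one h.symm
  rw [if_neg (lt_irrefl _), if_pos (by omega), zero_add]

theorem EmptyRect.cornerSum_eq_zero {a b c : Fin n} (h : EmptyRect x a b) (hca : c ≠ a)
    (hcb : c ≠ b) : cornerSum (rect x a b) c (x c) = 0 := by
  rw [cornerSum_rect]
  have h1 := cycDist_sub_one hca
  have h2 := cycDist_sub_one fun h' => hca (x.injective h')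
  have h3 : cycDist a c ≠ cycDist a b := fun h' => hcb (cycDist_inj h')
  rcases lt_or_ge (cycDist a c) (cycDist a b) with h4 | h4
  · have h5 := h.empty c hca h4
    rw [mul_eq_zero]
    right
    rw [if_neg (by omega), if_neg (by omega), add_zero]
  · rw [if_neg (by omega), if_neg (by omega), add_zero, zero_mul]

/-- Each of the four corners of the rectangle contributes `1`, and by emptiness the other points see
none of it. -/
theorem EmptyRect.domainIndex {a b : Fin n} (h : EmptyRect x a b) :
    domainIndex (rect x a b) x (x * Equiv.swap a b) = 4 := by
  have hx : x a ≠ x b := fun h' => h.ne (x.injective h')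
  have hsum : ∀ f : Fin n → ℤ, (∀ c, c ≠ a → c ≠ b → f c = 0) → f a = 1 → f b = 1 →
      ∑ c, f c = 2 := by
    intro f h1 h2 h3
    rw [← Finset.sum_subset (Finset.subset_univ {a, b}), Finset.sum_pair h.ne, h2, h3]
    · norm_num
    · intro c _ hc
      simp only [Finset.mem_insert, Finset.mem_singleton, not_or] at hc
      exact h1 c hc.1 hc.2
  have ha : ∀ j, (j = x a ∨ j = x b) → cornerSum (rect x a b) a j = 1 := by
    rintro j (rfl | rfl) <;> rw [cornerSum_rect, cycDist_indicator_add_left h.ne]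
    · rw [cycDist_indicator_add_left hx, mul_one]
    · rw [cycDist_indicator_add_right hx, mul_one]
  have hb : ∀ j, (j = x a ∨ j = x b) → cornerSum (rect x a b) b j = 1 := by
    rintro j (rfl | rfl) <;> rw [cornerSum_rect, cycDist_indicator_add_right h.ne]
    · rw [cycDist_indicator_add_left hx, mul_one]
    · rw [cycDist_indicator_add_right hx, mul_one]
  have h1 := hsum (fun c => cornerSum (rect x a b) c (x c))
    (fun c h1 h2 => h.cornerSum_eq_zero h1 h2) (ha _ (Or.inl rfl)) (hb _ (Or.inr rfl))
  have h2 := hsum (fun c => cornerSum (rect x a b) c ((x * Equiv.swap a b) c))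
    (fun c h1 h2 => by rw [mul_swap_of_ne h1 h2]; exact h.cornerSum_eq_zero h1 h2)
    (ha _ (Or.inr (mul_swap_left x a b))) (hb _ (Or.inl (mul_swap_right x a b)))
  rw [_root_.domainIndex, h1, h2]
  norm_num

/-- In a grid diagram of a knot, domains between given generators are determined by their
coefficients at the markings. -/
theorem Connects.eq_of_isKnot {G : GridDiagram n} (hK : G.IsKnot) (h : Connects D x y)
    (h' : Connects E x y) (hX : ∀ c, D c (G.X c) = E c (G.X c))
    (hO : ∀ c, D c (G.O c) = E c (G.O c)) : D = E := by
  have hp : Connects (D - E) y y := h.sub h'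
  set F := D - E with hF
  have hX' : ∀ c, F c (G.X c) = 0 := fun c => by simp [hF, hX c]
  have hO' : ∀ c, F c (G.O c) = 0 := fun c => by simp [hF, hO c]
  have happ : ∀ (σ : Equiv.Perm (Fin n)) c, σ (σ⁻¹ c) = c := fun σ c => σ.apply_symm_apply c
  -- A periodic domain is a function of the column plus one of the row. Two columns whose `X` and
  -- `O` share a row, with both coefficients zero, have equal column parts; for a knot this links
  -- all columns.
  have hstep : ∀ c, F ((G.O⁻¹ * G.X) c) 0 = F c 0 := by
    intro c
    have h1 := hp.periodic c (G.X c)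
    have h2 := hp.periodic ((G.O⁻¹ * G.X) c) (G.X c)
    have h3 := hO' ((G.O⁻¹ * G.X) c)
    rw [Equiv.Perm.mul_apply, happ] at h3
    rw [Equiv.Perm.mul_apply] at h2 ⊢
    rw [h3] at h2
    rw [hX'] at h1
    linarith
  have hpow : ∀ (k : ℤ) c, F (((G.O⁻¹ * G.X) ^ k) c) 0 = F c 0 := by
    intro k
    induction k using Int.induction_on with
    | zero => simp
    | succ k ih => intro c; rw [zpow_add_one, Equiv.Perm.mul_apply, ih, hstep]
    | pred k ih =>
      intro c
      rw [zpow_sub_one, Equiv.Perm.mul_apply, ih, ← hstep, happ]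
  have hcol : ∀ c, F c 0 = F 0 0 := by
    intro c
    obtain ⟨k, hk⟩ := hK.2 (Set.mem_univ 0) (Set.mem_univ c)
    rw [← hk, hpow]
  have hF0 : F = 0 := by
    funext c r
    have h1 := hp.periodic c r
    have h2 := hp.periodic (G.X.symm r) r
    have h3 := hX' (G.X.symm r)
    rw [Equiv.apply_symm_apply] at h3
    rw [h3, hcol] at h2
    rw [hcol] at h1
    simp only [Pi.zero_apply]
    linarith
  exact sub_eq_zero.1 hF0

end Torus

namespace StabilizationDiagram

variable {N : ℕ} {S : StabilizationDiagram N}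

/-! ### Domains near the point `ρ` -/

theorem zero_sub_one_eq_last : (0 : Fin (N + 2)) - 1 = Fin.last (N + 1) := by
  rw [sub_eq_iff_eq_add]
  exact (Fin.last_add_one (N + 1)).symm

theorem G_O_zero : S.G.O 0 = 0 := extendPerm_zero _

theorem G_O_succ (c : Fin (N + 1)) : S.G.O c.succ = (S.H.O c).succ := extendPerm_succ _ _

theorem G_X_zero : S.G.X 0 = Fin.last (N + 1) := by
  change extendPerm S.H.X (Equiv.swap 0 (Fin.last (N + 1)) 0) = _
  rw [Equiv.swap_apply_left, ← Fin.succ_last, extendPerm_succ, S.X_last]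

theorem G_X_last : S.G.X (Fin.last (N + 1)) = 0 := by
  change extendPerm S.H.X (Equiv.swap 0 (Fin.last (N + 1)) (Fin.last (N + 1))) = _
  rw [Equiv.swap_apply_right, extendPerm_zero]

theorem fInv_zero (y : GridGen (N + 1)) : fInv y 0 = 0 := extendPerm_zero _

theorem fInv_injective : Function.Injective (fInv : GridGen (N + 1) → GridGen (N + 2)) := by
  intro y z h
  ext1 i
  have h1 := congrArg (fun σ : GridGen (N + 2) => σ i.succ) h
  simpa [fInv] using h1

theorem exists_fInv_eq {x : GridGen (N + 2)} (h : x 0 = 0) : ∃ y, fInv y = x := by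
  obtain ⟨p, rfl⟩ := Equiv.Perm.decomposeFin.symm.surjective x
  obtain ⟨i, y⟩ := p
  rw [Equiv.Perm.decomposeFin_symm_apply_zero] at h
  subst h
  exact ⟨y, rfl⟩

/-- The four components around `ρ` contain, in the order written, `X_1`, `X_0`, `O_0` and no
marking. -/
theorem connects_at_rho {D : GridChain (N + 2)} {x y : GridGen (N + 2)} (h : Connects D x y) :
    D (Fin.last _) 0 + D 0 (Fin.last _) - D 0 0 - D (Fin.last _) (Fin.last _) =
      (if y 0 = 0 then 1 else 0) - (if x 0 = 0 then 1 else 0) := by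
  rw [← h 0 0]
  simp only [alphaBoundary, zero_sub_one_eq_last]
  ring

theorem last_ne_zero' : Fin.last (N + 1) ≠ 0 := by simp [Fin.ext_iff]

/-- The jump of a domain across `β_0`. -/
theorem connects_beta_zero {D : GridChain (N + 2)} {x y : GridGen (N + 2)} (h : Connects D x y)
    (j : Fin (N + 2)) : (D 0 j - D (Fin.last _) j) - (D 0 (j - 1) - D (Fin.last _) (j - 1)) =
      (if x 0 = j then 1 else 0) - (if y 0 = j then 1 else 0) := by
  have h1 := h 0 j
  simp only [alphaBoundary, zero_sub_one_eq_last] at h1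
  linarith

theorem sub_last_col_const {D : GridChain (N + 2)} {x y : GridGen (N + 2)} (h : Connects D x y)
    (hxy : x 0 = y 0) (j : Fin (N + 2)) : D 0 j - D (Fin.last _) j = D 0 0 - D (Fin.last _) 0 :=
  fin_cyclic_const (fun j => D 0 j - D (Fin.last _) j) (fun j => by
    have h1 := connects_beta_zero h j
    rw [hxy, sub_self] at h1
    linarith) j

theorem sub_last_row_const {D : GridChain (N + 2)} {x y : GridGen (N + 2)} (h : Connects D x y)
    (hx : x 0 = 0) (hy : y 0 = 0) (i : Fin (N + 2)) :
    D i 0 - D i (Fin.last _) = D 0 0 - D 0 (Fin.last _) := by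
  have h0 : ∀ (σ : GridGen (N + 2)) i, σ 0 = 0 → (σ i = 0 ↔ i = 0) := fun σ i hσ =>
    ⟨fun h => σ.injective (h.trans hσ.symm), fun h => h ▸ hσ⟩
  refine fin_cyclic_const (fun i => D i 0 - D i (Fin.last _)) (fun i => ?_) i
  have h1 := h i 0
  simp only [alphaBoundary, zero_sub_one_eq_last, h0 x i hx, h0 y i hy] at h1
  linarith

/-- Domains of `G` between generators containing `ρ` which avoid the `X` markings come from
domains of `H`. -/
theorem exists_liftChain {y z : GridGen (N + 1)} {b : Fin (N + 2) → ℤ} {D : GridChain (N + 2)}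
    (h : S.G.PosDomain (fInv y) (fInv z) 0 b D) :
    b 0 = 0 ∧ ∃ E, S.H.PosDomain y z 0 (fun c => b c.succ) E := by
  have hrho := connects_at_rho h.connects
  have hX0 := h.atX 0
  have hXl := h.atX (Fin.last _)
  rw [G_X_zero] at hX0
  rw [G_X_last] at hXl
  have h00 := h.nonneg 0 0
  have hll := h.nonneg (Fin.last _) (Fin.last _)
  simp only [Pi.zero_apply] at hX0 hXl
  simp only [fInv_zero] at hrho
  have hO0 := h.atO 0
  rw [G_O_zero] at hO0
  -- The two `X` coefficients at `ρ` vanish, hence by positivity all four do. So nothing jumps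
  -- across `β_0`, nor across `α_0`.
  have hcol : ∀ j, D 0 j = D (Fin.last _) j := fun j => by
    have := sub_last_col_const h.connects (by rw [fInv_zero, fInv_zero]) j
    omega
  have hrow : ∀ i, D i 0 = D i (Fin.last _) := fun i => by
    have := sub_last_row_const h.connects (fInv_zero _) (fInv_zero _) i
    omega
  have hlift : D = liftChain fun c r => D c.succ r.succ := by
    funext c r
    simp only [liftChain]
    cases c using Fin.cases with
    | zero =>
      cases r using Fin.cases with
      | zero =>
        change D 0 0 = D (Fin.last (N + 1)) (Fin.last (N + 1))
        omega
      | succ r => exact hcol _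
    | succ c =>
      cases r using Fin.cases with
      | zero => exact hrow _
      | succ r => rfl
  refine ⟨by omega, fun c r => D c.succ r.succ, fun i j => ?_, fun c r => h.nonneg _ _,
    fun c => ?_, fun c => ?_⟩
  · have h1 := h.connects i.succ j.succ
    rw [hlift] at h1
    simp only [alphaBoundary, liftChain, collapse_sub_one, fInv, extendPerm_succ,
      Fin.succ_inj] at h1
    simpa [alphaBoundary, collapse] using h1
  · by_cases hc : c = Fin.last N
    · subst hc
      change D (Fin.last N).succ (S.H.X (Fin.last N)).succ = 0
      rw [S.X_last]
      change D (Fin.last (N + 1)) (Fin.last (N + 1)) = 0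
      omega
    · have h1 := h.atX c.succ
      have h2 : S.G.X c.succ = (S.H.X c).succ := by
        change extendPerm S.H.X (Equiv.swap 0 (Fin.last (N + 1)) c.succ) = _
        rw [Equiv.swap_apply_of_ne_of_ne (Fin.succ_ne_zero c), extendPerm_succ]
        rw [← Fin.succ_last]
        exact fun h => hc (Fin.succ_injective _ h)
      rwa [h2] at h1
  · have h1 := h.atO c.succ
    rwa [G_O_succ] at h1

/-! ### The minus stabilization poset in terms of domains of `G` -/

namespace MinusPoset

/-- The generator of `G` underlying an element of the minus stabilization poset. -/
def gen : MinusPoset S → GridGen (N + 2)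
  | .ofG x => x.gen
  | .ofH x => fInv x.gen

/-- `0` for elements from `G` and `1` for elements from `H`. -/
def level : MinusPoset S → ℤ
  | .ofG _ => 0
  | .ofH _ => 1

/-- The exponents after identifying `U_0` with `U_1`. -/
def expH : MinusPoset S → Fin (N + 1) → ℤ
  | .ofG x => fun c => x.exp c.succ + if c = S.colO1 then x.exp 0 else 0
  | .ofH x => fun c => x.exp c

/-- The exponent of `U_0` of an element from `G`. -/
def exp0 : MinusPoset S → ℤ
  | .ofG x => x.exp 0
  | .ofH _ => 0

theorem level_eq (p : MinusPoset S) : level p = 0 ∨ level p = 1 := by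
  cases p
  · exact Or.inl rfl
  · exact Or.inr rfl

theorem expH_nonneg (p : MinusPoset S) (c : Fin (N + 1)) : 0 ≤ expH p c := by
  cases p <;> simp only [expH]
  · split_ifs <;> positivity
  · positivity

theorem gen_zero_of_level {p : MinusPoset S} (h : level p = 1) : gen p 0 = 0 := by
  cases p
  · simp [level] at h
  · exact fInv_zero _

theorem eq_of_data_eq {p q : MinusPoset S} (hl : level p = level q) (hg : gen p = gen q)
    (he : ∀ c, expH p c = expH q c) (h0 : level p = 0 → exp0 p = exp0 q) : p = q := by
  cases p <;> cases q
  · rename_i x y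
    have h1 : x.exp 0 = y.exp 0 := by
      have := h0 rfl
      simp only [exp0] at this
      omega
    refine congrArg _ (MinusGen.ext hg (funext fun c => ?_))
    cases c using Fin.cases with
    | zero => exact h1
    | succ c =>
      have := he c
      simp only [expH, h1] at this
      omega
  · simp [level] at hl
  · simp [level] at hl
  · rename_i x y
    refine congrArg _ (MinusGen.ext (fInv_injective hg) (funext fun c => ?_))
    have := he c
    simp only [expH] at this
    omega

/-- `D` is a domain in `G` showing that `q ≼ p`. -/
structure IsDomain (p q : MinusPoset S) (D : GridChain (N + 2)) : Prop where
  connects : Connects D (gen p) (gen q)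
  nonneg : ∀ c r, 0 ≤ D c r
  atX : ∀ c, c ≠ 0 → D c (S.G.X c) = 0
  atX0 : D 0 (Fin.last _) = level q - level p
  -- The coefficient at `O_0` counts towards `U_1`. It is recorded separately only while the end
  -- still lies in `G`.
  atO : ∀ c, D c.succ (S.G.O c.succ) + (if c = S.colO1 then D 0 0 else 0) = expH q c - expH p c
  atO0 : level q = 0 → D 0 0 = exp0 q - exp0 p

theorem ofG_le_ofG {x y : MinusGen (N + 2)} :
    (ofG y : MinusPoset S) ≤ ofG x ↔ ∃ D, IsDomain (S := S) (ofG x) (ofG y) D := by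
  change S.G.MinusLE y x ↔ _
  constructor
  · rintro ⟨D, hD⟩
    have h0 := hD.atO 0
    have hX := hD.atX 0
    rw [G_O_zero] at h0
    rw [G_X_zero] at hX
    refine ⟨D, hD.connects, hD.nonneg, fun c _ => hD.atX c, hX, fun c => ?_, fun _ => h0⟩
    rw [hD.atO, h0]
    simp only [expH]
    split_ifs <;> ring
  · rintro ⟨D, hD⟩
    refine ⟨D, hD.connects, hD.nonneg, fun c => ?_, fun c => ?_⟩
    · by_cases hc : c = 0
      · rw [hc, G_X_zero]; exact hD.atX0
      · exact hD.atX c hc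
    · have h0 := hD.atO0 rfl
      simp only [exp0] at h0
      cases c using Fin.cases with
      | zero => rw [G_O_zero]; exact h0
      | succ c =>
        have h1 := hD.atO c
        simp only [expH] at h1
        split_ifs at h1 <;> linarith

theorem ofH_le_ofH {x y : MinusGen (N + 1)} :
    (ofH y : MinusPoset S) ≤ ofH x ↔ ∃ D, IsDomain (S := S) (ofH x) (ofH y) D := by
  change S.H.MinusLE y x ↔ _
  constructor
  · rintro ⟨E, hE⟩
    have hD := liftChain_posDomain hE
    have h0 := hD.atO 0
    have hX := hD.atX 0
    rw [G_O_zero, Fin.cons_zero] at h0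
    rw [G_X_zero] at hX
    refine ⟨liftChain E, hD.connects, hD.nonneg, fun c _ => hD.atX c, by rw [hX]; rfl,
      fun c => ?_, fun h => ?_⟩
    · rw [hD.atO, h0, Fin.cons_succ]
      simp only [expH, ite_self, add_zero]
    · simp [level] at h
  · rintro ⟨D, hD⟩
    have hP : S.G.PosDomain (fInv x.gen) (fInv y.gen) 0 (fun c => D c (S.G.O c)) D := by
      refine ⟨hD.connects, hD.nonneg, fun c => ?_, fun c => rfl⟩
      by_cases hc : c = 0
      · rw [hc, G_X_zero]; exact hD.atX0
      · exact hD.atX c hc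
    obtain ⟨h0, E, hE⟩ := exists_liftChain hP
    rw [G_O_zero] at h0
    refine ⟨E, hE.connects, hE.nonneg, hE.atX, fun c => ?_⟩
    have h1 := hD.atO c
    rw [h0] at h1
    rw [hE.atO]
    simpa [expH] using h1

theorem ofH_le_ofG {x : MinusGen (N + 2)} {y : MinusGen (N + 1)} :
    (ofH y : MinusPoset S) ≤ ofG x ↔ ∃ D, IsDomain (S := S) (ofG x) (ofH y) D := by
  change (∃ (k : Fin (N + 2) → ℕ) (D : GridChain (N + 2)), _) ↔ _
  constructor
  · rintro ⟨k, D, hD, hk⟩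
    have h0 := hD.atO 0
    have hX := hD.atX 0
    rw [G_O_zero] at h0
    rw [G_X_zero] at hX
    refine ⟨D, hD.connects, hD.nonneg, fun c hc => ?_, by rw [hX]; rfl, fun c => ?_, fun h => ?_⟩
    · rw [hD.atX]; exact if_neg hc
    · rw [hD.atO, h0]
      simp only [expH, hk c]
      split_ifs <;> push_cast <;> ring
    · simp [level] at h
  · rintro ⟨D, hD⟩
    refine ⟨fun c => (D c (S.G.O c)).toNat, D, ⟨hD.connects, hD.nonneg, fun c => ?_, fun c => ?_⟩,
      fun c => ?_⟩
    · by_cases hc : c = 0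
      · rw [hc, G_X_zero, hD.atX0]; rfl
      · rw [hD.atX c hc]; exact (if_neg hc).symm
    · rw [Int.toNat_of_nonneg (hD.nonneg _ _)]
    · have h1 := hD.atO c
      have h2 := hD.nonneg 0 0
      have h3 := hD.nonneg c.succ (S.G.O c.succ)
      simp only [expH] at h1
      simp only [G_O_zero]
      split_ifs at h1 ⊢ <;> omega

theorem le_iff {p q : MinusPoset S} : q ≤ p ↔ ∃ D, IsDomain p q D := by
  cases p <;> cases q
  · exact ofG_le_ofG
  · exact ofH_le_ofG
  · refine ⟨fun h => False.elim h, fun ⟨D, hD⟩ => ?_⟩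
    have h1 := hD.atX0
    have h2 := hD.nonneg 0 (Fin.last _)
    simp only [level] at h1
    omega
  · exact ofH_le_ofH

namespace IsDomain

variable {p q r u : MinusPoset S} {D E : GridChain (N + 2)}

theorem level_le (h : IsDomain p q D) : level p ≤ level q := by
  have h1 := h.atX0
  have h2 := h.nonneg 0 (Fin.last _)
  omega

theorem add (h : IsDomain p q D) (h' : IsDomain q r E) : IsDomain p r (D + E) where
  connects := h.connects.add h'.connects
  nonneg c r := add_nonneg (h.nonneg c r) (h'.nonneg c r)
  atX c hc := by simp [h.atX c hc, h'.atX c hc]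
  atX0 := by simp [h.atX0, h'.atX0]
  atO c := by
    have h1 := h.atO c
    have h2 := h'.atO c
    simp only [Pi.add_apply]
    split_ifs at * <;> linarith
  atO0 hr := by
    have h1 := h'.level_le
    have h2 := level_eq q
    simp only [Pi.add_apply, h.atO0 (by omega), h'.atO0 hr]
    ring

theorem sub (h : IsDomain p q D) (h' : IsDomain p u E) (hle : ∀ c r, E c r ≤ D c r) :
    IsDomain u q (D - E) where
  connects := h.connects.sub h'.connects
  nonneg c r := sub_nonneg.2 (hle c r)
  atX c hc := by simp [h.atX c hc, h'.atX c hc]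
  atX0 := by simp [h.atX0, h'.atX0]
  atO c := by
    have h1 := h.atO c
    have h2 := h'.atO c
    simp only [Pi.sub_apply]
    split_ifs at * <;> linarith
  atO0 hq := by
    have h1 := h.atX0
    have h2 := h'.atX0
    have h3 := hle 0 (Fin.last _)
    have h4 := level_eq u
    simp only [Pi.sub_apply, h.atO0 hq, h'.atO0 (by omega)]
    ring

end IsDomain

/-- A domain to an element from `H` has coefficient `0` at the components of `ρ` which do not
contain an `X` marking. -/
def Tame (q : MinusPoset S) (D : GridChain (N + 2)) : Prop :=
  level q = 1 → D 0 0 = 0 ∧ D (Fin.last _) (Fin.last _) = 0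

/-- `p` comes from a generator of `G` containing `ρ`, and `q` from one of `H`. -/
def Special (p q : MinusPoset S) : Prop := level p = 0 ∧ level q = 1 ∧ gen p 0 = 0

namespace IsDomain

variable {p q : MinusPoset S} {D E : GridChain (N + 2)}

theorem at_rho (h : IsDomain p q D) :
    level q - level p - D 0 0 - D (Fin.last _) (Fin.last _) =
      (if gen q 0 = 0 then 1 else 0) - (if gen p 0 = 0 then 1 else 0) := by
  rw [← connects_at_rho h.connects, h.atX0]
  have h1 := h.atX _ last_ne_zero'
  rw [G_X_last] at h1
  rw [h1]
  ring

/-- Passing from a generator without `ρ` to one with `ρ` across `X_0` already balances the relation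
at `ρ`, as does staying among elements from `H`; nothing is left for the other two components. -/
theorem tame (h : IsDomain p q D) (hs : ¬ Special p q) : Tame q D := by
  intro hq
  have h1 := h.at_rho
  have h2 := h.nonneg 0 0
  have h3 := h.nonneg (Fin.last _) (Fin.last _)
  rw [if_pos (gen_zero_of_level hq), hq] at h1
  rcases level_eq p with hp | hp
  · rw [if_neg fun h0 => hs ⟨hp, hq, h0⟩, hp] at h1
    omega
  · rw [if_pos (gen_zero_of_level hp), hp] at h1
    omega

/-- Away from the row and column of `X_0` the `X` markings give the zeros. There, either `X_0`
itself or the components at `ρ` provided by tameness serve. -/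
theorem hasZeros (h : IsDomain p q D) (ht : Tame q D) : HasZeros D := by
  have h0 : level q ≠ 1 → D 0 (Fin.last _) = 0 := fun hq => by
    have h1 := h.atX0
    have h2 := h.level_le
    have h3 := level_eq q
    have h4 := level_eq p
    omega
  refine ⟨fun c => ?_, fun r => ?_⟩
  · by_cases hc : c = 0
    · subst hc
      by_cases hq : level q = 1
      · exact ⟨0, (ht hq).1⟩
      · exact ⟨_, h0 hq⟩
    · exact ⟨_, h.atX c hc⟩
  · by_cases hc : S.G.X.symm r = 0
    · obtain rfl : r = Fin.last _ := by rw [← G_X_zero (S := S), ← hc, Equiv.apply_symm_apply]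
      by_cases hq : level q = 1
      · exact ⟨Fin.last _, (ht hq).2⟩
      · exact ⟨_, h0 hq⟩
    · have h1 := h.atX _ hc
      rw [Equiv.apply_symm_apply] at h1
      exact ⟨_, h1⟩

/-- Tameness fixes the coefficient at `O_0`, which the identification of `U_0` with `U_1` would
leave open. -/
theorem eq_of_tame (hK : S.G.IsKnot) (h : IsDomain p q D) (ht : Tame q D) (h' : IsDomain p q E)
    (ht' : Tame q E) : D = E := by
  have h0 : D 0 0 = E 0 0 := by
    rcases level_eq q with hq | hq
    · rw [h.atO0 hq, h'.atO0 hq]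
    · rw [(ht hq).1, (ht' hq).1]
  refine h.connects.eq_of_isKnot hK h'.connects (fun c => ?_) fun c => ?_
  · by_cases hc : c = 0
    · rw [hc, G_X_zero, h.atX0, h'.atX0]
    · rw [h.atX c hc, h'.atX c hc]
  · cases c using Fin.cases with
    | zero => rw [G_O_zero, h0]
    | succ c =>
      have h1 := h.atO c
      have h2 := h'.atO c
      rw [h0] at h1
      linarith

/-- The `X` markings alone determine the index, so the ambiguity in the special case does no harm.
-/
theorem index_eq (h : IsDomain p q D) (h' : IsDomain p q E) :
    domainIndex D (gen p) (gen q) = domainIndex E (gen p) (gen q) := by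
  refine h.connects.domainIndex_eq h'.connects S.G.X fun c => ?_
  by_cases hc : c = 0
  · rw [hc, G_X_zero, h.atX0, h'.atX0]
  · rw [h.atX c hc, h'.atX c hc]

theorem eq_of_zero (h : IsDomain p q 0) : p = q := by
  have h1 := h.atX0
  have h2 := h.atO
  have h3 := h.atO0
  simp only [Pi.zero_apply, ite_self, add_zero] at h1 h2 h3
  refine eq_of_data_eq (by omega) h.connects.eq_of_zero (fun c => ?_) fun hp => ?_
  · have := h2 c
    omega
  · have := h3 (by omega)
    omega

end IsDomain

/-- Every suitable domain starting at `p` ends at some element of the poset. -/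
theorem exists_isDomain (p : MinusPoset S) {D : GridChain (N + 2)} {x : GridGen (N + 2)}
    (hc : Connects D (gen p) x) (hD : ∀ c r, 0 ≤ D c r)
    (hX : ∀ c, c ≠ 0 → D c (S.G.X c) = 0)
    (hl : level p + D 0 (Fin.last _) = 0 ∨ level p + D 0 (Fin.last _) = 1 ∧ x 0 = 0) :
    ∃ u, gen u = x ∧ IsDomain p u D := by
  rcases hl with hl | ⟨hl, hx⟩
  · have h0 := hD 0 (Fin.last _)
    cases p with
    | ofH p => simp only [level] at hl; omega
    | ofG p =>
      refine ⟨ofG ⟨x, fun c => (p.exp c + D c (S.G.O c)).toNat⟩, rfl, hc, hD, hX, ?_, fun c => ?_,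
        fun _ => ?_⟩
      · simp only [level] at hl ⊢
        omega
      · have h1 := hD c.succ (S.G.O c.succ)
        have h2 := hD 0 0
        simp only [expH, G_O_zero]
        split_ifs <;> omega
      · have h2 := hD 0 0
        simp only [exp0, G_O_zero]
        omega
  · obtain ⟨y, rfl⟩ := exists_fInv_eq hx
    refine ⟨ofH ⟨y, fun c => (expH p c + D c.succ (S.G.O c.succ) +
      if c = S.colO1 then D 0 0 else 0).toNat⟩, rfl, hc, hD, hX, ?_, fun c => ?_, fun h => ?_⟩
    · simp only [level] at hl ⊢
      omega
    · have h1 := hD c.succ (S.G.O c.succ)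
      have h2 := hD 0 0
      have h3 := expH_nonneg p c
      change _ = ((Int.toNat _ : ℕ) : ℤ) - _
      split_ifs <;> omega
    · simp [level] at h

/-! ### Labelled coverings of the minus poset -/

/-- `u` is obtained from `p` by an empty rectangle with label `l`. -/
def Step (p u : MinusPoset S) (l : ℕ) : Prop :=
  ∃ a b, l = rectLabel a b ∧ EmptyRect (gen p) a b ∧ gen u = gen p * Equiv.swap a b ∧
    IsDomain p u (rect (gen p) a b)

/-- The point at issue is that the rectangle ends in the poset: when the level is `1`, tameness and
the relation at `ρ` force the new generator to contain `ρ`. -/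
theorem exists_step_of_rect {p q : MinusPoset S} {D : GridChain (N + 2)} (h : IsDomain p q D)
    (ht : Tame q D) {a b : Fin (N + 2)} (he : EmptyRect (gen p) a b)
    (hle : ∀ c r, rect (gen p) a b c r ≤ D c r) :
    ∃ u, Step p u (rectLabel a b) ∧ q ≤ u := by
  set R := rect (gen p) a b with hR
  have hR0 : ∀ c r, 0 ≤ R c r := rect_nonneg _ _ _
  have hX : ∀ c, c ≠ 0 → R c (S.G.X c) = 0 := fun c hc =>
    le_antisymm (h.atX c hc ▸ hle _ _) (hR0 _ _)
  have hX0 : 0 ≤ R 0 (Fin.last _) ∧ R 0 (Fin.last _) ≤ level q - level p :=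
    ⟨hR0 _ _, h.atX0 ▸ hle _ _⟩
  have hcon := connects_rect (x := gen p) he.ne
  have hl : level p + R 0 (Fin.last _) = 0 ∨
      level p + R 0 (Fin.last _) = 1 ∧ (gen p * Equiv.swap a b) 0 = 0 := by
    have hp := level_eq p
    have hq := level_eq q
    by_cases h0 : level p + R 0 (Fin.last _) = 0
    · exact Or.inl h0
    · refine Or.inr ⟨by omega, ?_⟩
      have hq1 : level q = 1 := by omega
      obtain ⟨h1, h2⟩ := ht hq1
      have h3 := connects_at_rho hcon
      have h4 := hX _ last_ne_zero'
      rw [G_X_last] at h4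
      have h5 := hle 0 0
      have h6 := hle (Fin.last _) (Fin.last _)
      have h7 := hR0 0 0
      have h8 := hR0 (Fin.last _) (Fin.last _)
      have h9 : level p = 1 → gen p 0 = 0 := gen_zero_of_level
      rw [← hR] at h3
      by_contra hne
      rw [if_neg hne] at h3
      split_ifs at h3 with h10
      · omega
      · have := mt h9 h10
        omega
  obtain ⟨u, hu, hdom⟩ := exists_isDomain p hcon hR0 hX hl
  exact ⟨u, ⟨a, b, rfl, he, hu, hdom⟩, le_iff.2 ⟨_, h.sub hdom hle⟩⟩

theorem rectLabel_zero_one_le {a b : Fin (N + 2)} (h : a ≠ b) :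
    rectLabel (0 : Fin (N + 2)) 1 ≤ rectLabel a b := by
  have h1 : rectLabel (0 : Fin (N + 2)) 1 = 1 := by simp [rectLabel]
  rw [h1]
  by_contra hcon
  have h2 := Fin.val_ne_of_ne h
  have h3 := b.isLt
  unfold rectLabel at hcon
  split_ifs at hcon with h4
  · have := Fin.lt_def.1 h4
    omega
  · omega

theorem cycDist_zero_one : cycDist (0 : Fin (N + 2)) 1 = 1 := by simp [cycDist]

theorem cycDist_zero (c : Fin (N + 2)) : cycDist 0 c = c.val := by simp [cycDist]

theorem emptyRect_zero_one (x : GridGen (N + 2)) : EmptyRect x 0 1 := by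
  refine ⟨by simp, fun c hc h => ?_⟩
  rw [cycDist_zero_one] at h
  have := cycDist_pos.2 hc.symm
  omega

/-- From a generator containing `ρ` one can always start with the rectangle of width one to the
right of `ρ`. -/
theorem Special.exists_step {p q : MinusPoset S} (hs : Special p q) (hqp : q ≤ p) :
    ∃ u, Step p u (rectLabel (0 : Fin (N + 2)) 1) ∧ q ≤ u := by
  obtain ⟨hp, hq, hρ⟩ := hs
  set R := rect (gen p) 0 1 with hR
  have hR0 : ∀ c r, 0 ≤ R c r := rect_nonneg _ _ _
  have hcol : ∀ c r, c ≠ 0 → R c r = 0 := fun c r hc => rect_of_col (by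
    rw [cycDist_zero_one]
    have := cycDist_pos.2 hc.symm
    omega)
  have hlast : R 0 (Fin.last _) = 0 := rect_of_row (by
    rw [hρ, cycDist_zero, cycDist_zero]
    exact Fin.le_last _)
  obtain ⟨u, hu, hdom⟩ := exists_isDomain p (connects_rect (emptyRect_zero_one (gen p)).ne) hR0
    (fun c hc => hcol c _ hc) (Or.inl (by rw [hp, ← hR, hlast]; rfl))
  refine ⟨u, ⟨0, 1, rfl, emptyRect_zero_one _, hu, hdom⟩, ?_⟩
  -- No jump occurs along `β_0`, so column `0` exceeds the last column by `1` throughout and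
  -- contains the rectangle.
  have hmain : ∀ D, IsDomain p q D → D 0 0 = 1 → q ≤ u := by
    intro D hD h0
    refine le_iff.2 ⟨D - R, hD.sub hdom fun c r => ?_⟩
    by_cases hc : c = 0
    · subst hc
      have h1 := sub_last_col_const hD.connects (by rw [hρ, gen_zero_of_level hq]) r
      have h2 := hD.atX _ last_ne_zero'
      rw [G_X_last] at h2
      have h3 := hD.nonneg (Fin.last _) r
      refine le_trans (?_ : R 0 r ≤ 1) (by omega)
      rw [hR]
      unfold rect
      split_ifs <;> simp
    · rw [hcol c r hc]
      exact hD.nonneg c r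
  obtain ⟨D, hD⟩ := le_iff.1 hqp
  have h1 := hD.at_rho
  rw [if_pos hρ, if_pos (gen_zero_of_level hq), hp, hq] at h1
  have h2 := hD.nonneg 0 0
  have h3 := hD.nonneg (Fin.last _) (Fin.last _)
  by_cases h0 : D 0 0 = 1
  · exact hmain D hD h0
  · have h00 : D 0 0 = 0 := by omega
    have hX0 := hD.atX0
    have hrow : ∀ c, 1 ≤ D c (Fin.last _) := fun c => by
      have h4 := sub_last_row_const hD.connects hρ (gen_zero_of_level hq) c
      have h5 := hD.nonneg c 0
      omega
    -- `P` exchanges the horizontal annulus of `X_0` and `O_1`, which lies in `D` here, for the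
    -- vertical annulus of `X_0` and `O_0`. This changes no relation, since `U_0` and `U_1` agree in
    -- `H`.
    let P : GridChain (N + 2) := fun c r =>
      (if c = 0 then 1 else 0) - (if r = Fin.last _ then 1 else 0)
    have hPX : ∀ c, c ≠ 0 → P c (S.G.X c) = 0 := fun c hc => by
      have : S.G.X c ≠ Fin.last _ := fun h => hc (S.G.X.injective (h.trans G_X_zero.symm))
      simp [P, hc, this]
    refine hmain (D + P) ⟨?_, fun c r => ?_, fun c hc => ?_, ?_, fun c => ?_, fun h => by omega⟩ ?_
    · intro i j
      rw [← hD.connects i j]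
      simp only [alphaBoundary, P, Pi.add_apply]
      ring
    · simp only [Pi.add_apply, P]
      by_cases hr : r = Fin.last _
      · subst hr
        have := hrow c
        split_ifs <;> omega
      · have := hD.nonneg c r
        rw [if_neg hr]
        split_ifs <;> omega
    · simp [hPX c hc, hD.atX c hc]
    · rw [← hX0]
      simp [P]
    · rw [← hD.atO c]
      have h6 : S.G.O c.succ = Fin.last _ ↔ c = S.colO1 := by
        rw [G_O_succ, ← Fin.succ_last, Fin.succ_inj, colO1, Equiv.eq_symm_apply]
      simp only [Pi.add_apply, P, h6, Fin.succ_ne_zero, if_false, last_ne_zero'.symm, if_true]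
      split_ifs <;> ring
    · simp [P, h00, last_ne_zero'.symm]

/-- The jump along `β_0` of a domain ending at a generator containing `ρ`. -/
theorem IsDomain.pos_right_of_beta_zero {p q : MinusPoset S} {D : GridChain (N + 2)}
    (h : IsDomain p q D) (ht : Tame q D) (hq : level q = 1) (hρ : gen p 0 ≠ 0) {r : Fin (N + 2)}
    (hr : cycDist (gen p 0) r < cycDist (gen p 0) 0) : 0 < D 0 r := by
  have h1 := fin_cyclic_const (fun j => D 0 j - D (Fin.last _) j -
      (if cycDist (gen p 0) j < cycDist (gen p 0) 0 then 1 else 0)) (fun j => by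
    have h1 := connects_beta_zero h.connects j
    have h2 := cycDist_indicator_sub (gen p 0) 0 j hρ
    rw [gen_zero_of_level hq] at h1
    simp only [eq_comm (a := j)] at h2
    linarith) r
  have h2 := h.atX _ last_ne_zero'
  rw [G_X_last] at h2
  rw [if_pos hr, if_neg (lt_irrefl _), (ht hq).1, h2] at h1
  have := h.nonneg (Fin.last _) r
  omega

open Classical in
/-- Four times the length of maximal chains between two elements. -/
noncomputable def len (p q : MinusPoset S) : ℤ :=
  if h : ∃ D, IsDomain p q D then domainIndex h.choose (gen p) (gen q) else 0

theorem IsDomain.len_eq {p q : MinusPoset S} {D : GridChain (N + 2)} (h : IsDomain p q D) :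
    len p q = domainIndex D (gen p) (gen q) := by
  have hex : ∃ D, IsDomain p q D := ⟨D, h⟩
  rw [len, dif_pos hex]
  exact hex.choose_spec.index_eq h

theorem Step.le {p u : MinusPoset S} {l : ℕ} (h : Step p u l) : u ≤ p := by
  obtain ⟨a, b, -, -, -, h⟩ := h
  exact le_iff.2 ⟨_, h⟩

theorem Step.label_ge {p u : MinusPoset S} {l : ℕ} (h : Step p u l) :
    rectLabel (0 : Fin (N + 2)) 1 ≤ l := by
  obtain ⟨a, b, rfl, h, -⟩ := h
  exact rectLabel_zero_one_le h.ne

theorem exists_step_of_lt {p q : MinusPoset S} (h : q < p) : ∃ u l, Step p u l ∧ q ≤ u := by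
  by_cases hs : Special p q
  · obtain ⟨u, hu⟩ := Special.exists_step hs h.le
    exact ⟨u, _, hu⟩
  · obtain ⟨D, hD⟩ := le_iff.1 h.le
    have ht := hD.tame hs
    obtain ⟨a, b, he, hle⟩ := hD.connects.exists_emptyRect_of_ne_zero hD.nonneg (hD.hasZeros ht)
      (by rintro rfl; exact h.ne' hD.eq_of_zero)
    obtain ⟨u, hu⟩ := exists_step_of_rect hD ht he hle
    exact ⟨u, _, hu⟩

/-- In the special case `l` is not the least label, so the rectangle to the right of `ρ` improves
it; otherwise `hasSmallerRect_add` applies. -/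
theorem improve_step {p z q : MinusPoset S} {l l' : ℕ} (h : Step p z l) (h' : Step z q l')
    (hl : l' < l) : ∃ u m, Step p u m ∧ q ≤ u ∧ m < l := by
  by_cases hs : Special p q
  · obtain ⟨u, hu, hqu⟩ := Special.exists_step hs (h'.le.trans h.le)
    have := h'.label_ge
    exact ⟨u, _, hu, hqu, by omega⟩
  · obtain ⟨a, b, rfl, he, hz, hd⟩ := h
    obtain ⟨a', b', rfl, he', hq, hd'⟩ := h'
    have hD := hd.add hd'
    have ht := hD.tame hs
    rw [hz] at he'
    have hsum : rect (gen p) a b + rect (gen z) a' b' =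
        rect (gen p) a b + rect (gen p * Equiv.swap a b) a' b' := by rw [hz]
    obtain ⟨i, j, h1, h2, h3⟩ := hD.connects.hasSmallerRect_add (hD.hasZeros ht) he he' hsum hl
    obtain ⟨u, hu, hqu⟩ := exists_step_of_rect hD ht h1 h2
    exact ⟨u, _, hu, hqu, h3⟩

theorem descend_step_of_special {p z q : MinusPoset S} {l : ℕ} (hs : Special p q)
    (h : Step p z l) (hqz : q ≤ z) (hl : rectLabel (0 : Fin (N + 2)) 1 < l) :
    ∃ u k, Step z u k ∧ q ≤ u ∧ k < l := by
  obtain ⟨hp, hq, hρ⟩ := hs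
  obtain ⟨a, b, rfl, he, hz, hd⟩ := h
  -- To keep `ρ`, an empty rectangle must avoid all four components around it, hence cannot cover
  -- `X_0`.
  have hlz : level z = 0 := by
    rcases level_eq z with h1 | h1
    · exact h1
    exfalso
    have h2 := gen_zero_of_level h1
    have h3 : (0 : Fin (N + 2)) ≠ a ∧ (0 : Fin (N + 2)) ≠ b := by
      rw [hz, ← hρ, Equiv.Perm.mul_apply] at h2
      have h4 := (gen p).injective h2
      rw [hρ] at h4
      constructor
      · rintro rfl
        rw [Equiv.swap_apply_left] at h4
        exact he.ne h4.symm
      · rintro rfl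
        rw [Equiv.swap_apply_right] at h4
        exact he.ne h4
    have h5 := he.cornerSum_eq_zero h3.1 h3.2
    have h6 := hd.atX0
    have h7 := rect_nonneg (gen p) a b
    have := h7 0 0
    have := h7 (Fin.last _) 0
    have := h7 (Fin.last _) (Fin.last _)
    rw [cornerSum, hρ, zero_sub_one_eq_last] at h5
    omega
  by_cases hρz : gen z 0 = 0
  · obtain ⟨u, hu, hqu⟩ := Special.exists_step ⟨hlz, hq, hρz⟩ hqz
    exact ⟨u, _, hu, hqu, hl⟩
  · obtain ⟨D, hD⟩ := le_iff.1 hqz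
    have ht := hD.tame fun h => hρz h.2.2
    -- If `a = 0`, the point on `β_0` has moved up to `gen p b`, and column `0` is positive from
    -- there to the top; so the width one rectangle still fits. Otherwise any rectangle starting on
    -- `β_0` has a smaller left side.
    by_cases ha : a = 0
    · subst ha
      have hb1 : b ≠ 1 := by
        rintro rfl
        exact lt_irrefl _ hl
      have hlt : cycDist (gen p 0) (gen p b) < cycDist (gen p 0) (gen p 1) := by
        refine he.empty 1 (by simp) ?_
        rw [cycDist_zero_one]
        have h1 := cycDist_pos.2 he.ne
        have h2 : cycDist 0 b ≠ cycDist 0 1 := fun h => hb1 (cycDist_inj h)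
        rw [cycDist_zero_one] at h2
        omega
      rw [hρ, cycDist_zero, cycDist_zero] at hlt
      have hz0 : gen z 0 = gen p b := by rw [hz, mul_swap_left]
      have hz1 : gen z 1 = gen p 1 := by rw [hz, mul_swap_of_ne (by simp) hb1.symm]
      obtain ⟨u, hu, hqu⟩ := exists_step_of_rect hD ht (emptyRect_zero_one _)
        ((rect_le_iff hD.nonneg).2 fun c r hc hr => by
          rw [cycDist_zero_one] at hc
          obtain rfl := cycDist_eq_zero.1 (Nat.lt_one_iff.1 hc)
          refine hD.pos_right_of_beta_zero ht hq hρz ?_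
          rw [hz1] at hr
          rw [hz0] at hr ⊢
          have h1 := cycDist_spec (gen p b) (gen p 1)
          have h2 := cycDist_spec (gen p b) 0
          have h3 := (gen p 1).isLt
          have h4 : (gen p b).val ≠ 0 := fun h4 => hρz (by rw [hz0]; exact Fin.ext h4)
          simp only [Fin.val_zero] at h2
          omega)
      exact ⟨u, _, hu, hqu, hl⟩
    · obtain ⟨j, h1, h2⟩ := hD.connects.exists_emptyRect hD.nonneg (hD.hasZeros ht) (a := 0)
        (hD.pos_right_of_beta_zero ht hq hρz (by
          rw [cycDist_self]
          exact cycDist_pos.2 hρz))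
      obtain ⟨u, hu, hqu⟩ := exists_step_of_rect hD ht h1 h2
      exact ⟨u, _, hu, hqu, rectLabel_lt_of_left (Fin.pos_iff_ne_zero.2 ha)⟩

/-- Outside the special case the domains through `z` and through `w` are tame, hence equal, so both
rectangles lie in one domain. -/
theorem descend_step (hK : S.G.IsKnot) {p q z w : MinusPoset S} {l m : ℕ} (hz : Step p z l)
    (hw : Step p w m) (hqz : q ≤ z) (hqw : q ≤ w) (hl : m < l) :
    ∃ u k, Step z u k ∧ q ≤ u ∧ k < l := by
  by_cases hs : Special p q
  · have := hw.label_ge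
    exact descend_step_of_special hs hz hqz (by omega)
  · obtain ⟨a, b, rfl, he, hgz, hd⟩ := hz
    obtain ⟨i, j, rfl, he', hgw, hd'⟩ := hw
    obtain ⟨D, hD⟩ := le_iff.1 hqz
    obtain ⟨E, hE⟩ := le_iff.1 hqw
    have h1 := hd.add hD
    have h2 := hd'.add hE
    have ht := h1.tame hs
    have heq := h1.eq_of_tame hK ht h2 (h2.tame hs)
    have hR := rect_nonneg (gen p) a b
    obtain ⟨i', j', h3, h4, h5⟩ := h1.connects.hasSmallerRect_sub h1.nonneg (h1.hasZeros ht) he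
      (fun c r => le_add_of_nonneg_right (hD.nonneg c r)) he'
      (fun c r => by rw [heq]; exact le_add_of_nonneg_right (hE.nonneg c r)) hl
    rw [add_sub_cancel_left] at h4
    rw [← hgz] at h3 h4
    have htD : Tame q D := fun hq => by
      obtain ⟨h6, h7⟩ := ht hq
      simp only [Pi.add_apply] at h6 h7
      have := hR 0 0
      have := hR (Fin.last _) (Fin.last _)
      have := hD.nonneg 0 0
      have := hD.nonneg (Fin.last _) (Fin.last _)
      omega
    obtain ⟨u, hu, hqu⟩ := exists_step_of_rect hD htD h3 h4
    exact ⟨u, _, hu, hqu, h5⟩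

theorem step_unique {p w z : MinusPoset S} {l : ℕ} (hw : Step p w l) (hz : Step p z l) :
    w = z := by
  obtain ⟨a, b, rfl, he, hgw, hd⟩ := hw
  obtain ⟨i, j, hl, he', hgz, hd'⟩ := hz
  obtain ⟨rfl, rfl⟩ := rectLabel_inj he.ne he'.ne hl
  have h1 := hd.atX0
  have h2 := hd'.atX0
  have h3 : level w = level z := by omega
  refine eq_of_data_eq h3 (hgw.trans hgz.symm) (fun c => ?_) fun h => ?_
  · have h4 := hd.atO c
    have h5 := hd'.atO c
    omega
  · have h4 := hd.atO0 h
    have h5 := hd'.atO0 (h3 ▸ h)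
    omega

/-- The edge labelling of the minus stabilization poset. -/
noncomputable def edgeLabelling (hK : S.G.IsKnot) : EdgeLabelling (MinusPoset S) where
  step := Step
  len := len
  step_lt {p u l} h := by
    refine lt_of_le_of_ne h.le ?_
    rintro rfl
    obtain ⟨a, b, -, he, hg, -⟩ := h
    have h1 := congrArg (fun σ : GridGen (N + 2) => σ a) hg
    simp only [mul_swap_left] at h1
    exact he.ne ((gen u).injective h1)
  exists_step := exists_step_of_lt
  len_add {p q r} h h' := by
    obtain ⟨D, hD⟩ := le_iff.1 h'
    obtain ⟨E, hE⟩ := le_iff.1 h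
    rw [hD.len_eq, hE.len_eq, (hD.add hE).len_eq, hD.connects.domainIndex_add hE.connects]
  len_nonneg h := by
    obtain ⟨D, hD⟩ := le_iff.1 h
    rw [hD.len_eq]
    exact domainIndex_nonneg hD.nonneg
  len_step {p u l} h := by
    obtain ⟨a, b, -, he, hg, hd⟩ := h
    rw [hd.len_eq, hg, he.domainIndex]
  improve := improve_step
  descend := descend_step hK
  step_inj := step_unique

end MinusPoset

end StabilizationDiagram

/-! ### The hat stabilization poset over the minus one -/

namespace StabilizationDiagram

variable {N : ℕ} {S : StabilizationDiagram N}

namespace HatPoset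

/-- The element of the minus stabilization poset with trivial exponents corresponding to an
element of the hat stabilization poset; the copy `ofH'` is sent to the generators containing `ρ`. -/
def toMinus : HatPoset S → MinusPoset S
  | .ofG x => .ofG ⟨x, 0⟩
  | .ofH x => .ofH ⟨x, 0⟩
  | .ofH' x => .ofG ⟨fInv x, 0⟩

/-- The part of the hat stabilization poset to which an element belongs. -/
def kind : HatPoset S → ℕ
  | .ofG _ => 0
  | .ofH _ => 1
  | .ofH' _ => 2

theorem kind_eq_one_iff (p : HatPoset S) : kind p = 1 ↔ MinusPoset.level (toMinus p) = 1 := by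
  cases p <;> simp [kind, toMinus, MinusPoset.level]

theorem kind_le (p : HatPoset S) : kind p ≤ 2 := by
  cases p <;> simp [kind]

theorem eq_of_kind_eq {p q : HatPoset S} (hk : kind p = kind q) (h : toMinus p = toMinus q) :
    p = q := by
  cases p <;> cases q <;> simp [kind] at hk
  · simp only [toMinus, MinusPoset.ofG.injEq, MinusGen.mk.injEq, and_true] at h
    rw [h]
  · simp only [toMinus, MinusPoset.ofH.injEq, MinusGen.mk.injEq, and_true] at h
    rw [h]
  · simp only [toMinus, MinusPoset.ofG.injEq, MinusGen.mk.injEq, and_true] at h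
    rw [fInv_injective h]

theorem hatLE_iff_minusLE {n : ℕ} [NeZero n] {G : GridDiagram n} {x y : GridGen n} :
    G.HatLE y x ↔ G.MinusLE ⟨y, 0⟩ ⟨x, 0⟩ := by
  have h : (fun c => (((0 : Fin n → ℕ) c : ℕ) : ℤ) - ((0 : Fin n → ℕ) c : ℕ)) = 0 := by
    funext c
    simp
  simp only [GridDiagram.HatLE, GridDiagram.MinusLE, h]

theorem hatLE_iff_fInv {x y : GridGen (N + 1)} :
    S.H.HatLE y x ↔ S.G.HatLE (fInv y) (fInv x) := by
  constructor
  · rintro ⟨E, hE⟩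
    refine ⟨liftChain E, ?_⟩
    have h1 := liftChain_posDomain hE
    have h2 : (Fin.cons 0 0 : Fin (N + 2) → ℤ) = 0 := by
      funext c
      cases c using Fin.cases <;> rfl
    rwa [h2] at h1
  · rintro ⟨D, hD⟩
    obtain ⟨-, E, hE⟩ := exists_liftChain hD
    exact ⟨E, hE⟩

theorem le_iff {p q : HatPoset S} :
    q ≤ p ↔ (kind q = kind p ∨ kind p = 0) ∧ toMinus q ≤ toMinus p := by
  cases p <;> cases q
  · simp only [kind, true_or, true_and]
    exact hatLE_iff_minusLE
  · simp only [kind, or_true, true_and]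
    rename_i x y
    change (∃ D, S.G.PosDomain x (fInv y) onlyX0 0 D) ↔
      ∃ (k : Fin (N + 2) → ℕ) (D : GridChain (N + 2)),
        S.G.PosDomain x (fInv y) onlyX0 (fun c => (k c : ℤ)) D ∧
        ∀ c : Fin (N + 1), 0 = 0 + k c.succ + (if c = S.colO1 then 0 + k 0 else 0)
    constructor
    · rintro ⟨D, hD⟩
      exact ⟨0, D, ⟨hD.connects, hD.nonneg, hD.atX, hD.atO⟩, fun c => by simp⟩
    · rintro ⟨k, D, hD, hk⟩
      refine ⟨D, hD.connects, hD.nonneg, hD.atX, fun c => ?_⟩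
      rw [hD.atO]
      cases c using Fin.cases with
      | zero =>
        have h1 := hk S.colO1
        rw [if_pos rfl] at h1
        simp only [Pi.zero_apply]
        omega
      | succ c =>
        have h1 := hk c
        simp only [Pi.zero_apply]
        omega
  · simp only [kind, or_true, true_and]
    exact hatLE_iff_minusLE
  · exact ⟨fun h => False.elim h, fun h => by simp [kind] at h⟩
  · simp only [kind, true_or, true_and]
    exact hatLE_iff_minusLE
  · exact ⟨fun h => False.elim h, fun h => by simp [kind] at h⟩
  · exact ⟨fun h => False.elim h, fun h => by simp [kind] at h⟩
  · exact ⟨fun h => False.elim h, fun h => by simp [kind] at h⟩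
  · simp only [kind, true_or, true_and]
    exact hatLE_iff_fInv.trans hatLE_iff_minusLE

/-- With zero coefficients at `X_0`, `X_1` and `O_0`, positivity at `ρ` lets a domain remove `ρ` but
never create it. -/
theorem zero_of_ofG_le {y z : GridGen (N + 2)} (hy : y 0 = 0)
    (h : (MinusPoset.ofG ⟨y, 0⟩ : MinusPoset S) ≤ .ofG ⟨z, 0⟩) : z 0 = 0 := by
  obtain ⟨D, hD⟩ := MinusPoset.le_iff.1 h
  have h1 := hD.at_rho
  have h2 := hD.atO0 rfl
  have h3 := hD.nonneg (Fin.last _) (Fin.last _)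
  have hy' : MinusPoset.gen (.ofG ⟨y, 0⟩ : MinusPoset S) 0 = 0 := hy
  by_contra hz
  have hz' : MinusPoset.gen (.ofG ⟨z, 0⟩ : MinusPoset S) 0 ≠ 0 := hz
  rw [if_pos hy', if_neg hz'] at h1
  simp only [MinusPoset.level, MinusPoset.exp0, Pi.zero_apply] at h1 h2
  omega

/-- The elements between the images of two elements of the hat stabilization poset lift. -/
theorem exists_lift {p q : HatPoset S} {u : MinusPoset S} (hqp : q ≤ p) (hqu : toMinus q ≤ u)
    (hup : u ≤ toMinus p) :
    ∃ v, toMinus v = u ∧ q ≤ v ∧ v ≤ p ∧ (kind v = kind p ∨ kind v = 1) := by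
  obtain ⟨hk, -⟩ := le_iff.1 hqp
  suffices hs : ∃ v, toMinus v = u ∧ (kind q = kind v ∨ kind v = 0) ∧
      (kind v = kind p ∨ kind p = 0) ∧ (kind v = kind p ∨ kind v = 1) by
    obtain ⟨v, rfl, h1, h2, h3⟩ := hs
    exact ⟨v, rfl, le_iff.2 ⟨h1, hqu⟩, le_iff.2 ⟨h2, hup⟩, h3⟩
  cases u with
  | ofG z =>
    -- Exponents only grow on the way down, and they vanish at the lower end.
    have hz : z.exp = 0 := by
      funext c
      cases q with
      | ofG y => exact Nat.le_zero.1 (GridDiagram.MinusLE.exp_le (G := S.G) hqu c)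
      | ofH' y => exact Nat.le_zero.1 (GridDiagram.MinusLE.exp_le (G := S.G) hqu c)
      | ofH y =>
        obtain ⟨k, D, -, hk⟩ := hqu
        cases c using Fin.cases with
        | zero =>
          have h1 : 0 = _ := hk S.colO1
          rw [if_pos rfl] at h1
          simp only [Pi.zero_apply]
          omega
        | succ c =>
          have h1 : 0 = _ := hk c
          simp only [Pi.zero_apply]
          omega
    obtain ⟨z, e⟩ := z
    obtain rfl : e = 0 := hz
    cases p with
    | ofG x => exact ⟨.ofG z, rfl, Or.inr rfl, Or.inr rfl, Or.inl rfl⟩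
    | ofH x => exact False.elim hup
    | ofH' x =>
      cases q <;> simp [kind] at hk
      obtain ⟨y, rfl⟩ := exists_fInv_eq (zero_of_ofG_le (fInv_zero _) hqu)
      exact ⟨.ofH' y, rfl, Or.inl rfl, Or.inl rfl, Or.inl rfl⟩
  | ofH z =>
    cases q with
    | ofG y => exact False.elim hqu
    | ofH' y => exact False.elim hqu
    | ofH y =>
      obtain ⟨z, e⟩ := z
      obtain rfl : e = 0 :=
        funext fun c => Nat.le_zero.1 (GridDiagram.MinusLE.exp_le (G := S.H) hqu c)
      exact ⟨.ofH z, rfl, Or.inl rfl, hk, Or.inr rfl⟩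

/-- If `q` from `ofH'` lies below `p` from `ofG`, then `p` contains `ρ`. -/
theorem exists_prime {p q : HatPoset S} (hp : kind p = 0) (hq : kind q = 2)
    (h : toMinus q ≤ toMinus p) : ∃ u, kind u = 2 ∧ toMinus u = toMinus p ∧ q ≤ u := by
  cases p <;> simp [kind] at hp
  cases q <;> simp [kind] at hq
  obtain ⟨y, rfl⟩ := exists_fInv_eq (zero_of_ofG_le (fInv_zero _) h)
  exact ⟨.ofH' y, rfl, rfl, le_iff.2 ⟨Or.inl rfl, h⟩⟩

/-- The labelled coverings of the hat stabilization poset; the coverings between the two copies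
of a generator containing `ρ` have label `0`. -/
def Step (p u : HatPoset S) : ℕ → Prop
  | 0 => kind p = 0 ∧ kind u = 2 ∧ toMinus u = toMinus p
  | l + 1 => u ≤ p ∧ (kind u = kind p ∨ kind u = 1) ∧ (toMinus p).Step (toMinus u) l

theorem Step.le {p u : HatPoset S} {l : ℕ} (h : Step p u l) : u ≤ p := by
  cases l with
  | zero => exact le_iff.2 ⟨Or.inr h.1, h.2.2.le⟩
  | succ l => exact h.1

/-- The edge labelling of the hat stabilization poset. -/
noncomputable def edgeLabelling (hK : S.G.IsKnot) : EdgeLabelling (HatPoset S) where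
  step := Step
  -- The extra `4` is the change of copy, which `toMinus` does not see.
  len p q := MinusPoset.len (toMinus p) (toMinus q) + if kind p = 0 ∧ kind q = 2 then 4 else 0
  step_lt {p u l} h := by
    refine lt_of_le_of_ne h.le ?_
    rintro rfl
    cases l with
    | zero =>
      have h1 := h.1
      have h2 := h.2.1
      omega
    | succ l => exact lt_irrefl _ ((MinusPoset.edgeLabelling hK).step_lt h.2.2)
  exists_step {p q} h := by
    obtain ⟨hk, hle⟩ := le_iff.1 h.le
    rcases eq_or_lt_of_le hle with heq | hlt
    · refine ⟨q, 0, ⟨?_, ?_, heq⟩, le_rfl⟩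
      all_goals
        have h1 : kind q ≠ kind p := fun hk => h.ne (eq_of_kind_eq hk heq)
        have h2 := kind_eq_one_iff p
        have h3 := kind_eq_one_iff q
        rw [heq, ← h2] at h3
        have h4 := kind_le q
        omega
    · obtain ⟨u, l, hu, hqu⟩ := (MinusPoset.edgeLabelling hK).exists_step hlt
      obtain ⟨v, rfl, h1, h2, h3⟩ :=
        exists_lift h.le hqu ((MinusPoset.edgeLabelling hK).step_lt hu).le
      exact ⟨v, l + 1, ⟨h2, h3, hu⟩, h1⟩
  len_add {p q r} h h' := by
    obtain ⟨hk, hle⟩ := le_iff.1 h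
    obtain ⟨hk', hle'⟩ := le_iff.1 h'
    have h1 : MinusPoset.len _ _ = MinusPoset.len _ _ + MinusPoset.len _ _ :=
      (MinusPoset.edgeLabelling hK).len_add hle hle'
    rw [h1]
    split_ifs <;> omega
  len_nonneg {p q} h := by
    have h1 : 0 ≤ MinusPoset.len _ _ := (MinusPoset.edgeLabelling hK).len_nonneg (le_iff.1 h).2
    split_ifs <;> omega
  len_step {p u l} h := by
    cases l with
    | zero =>
      have h1 : MinusPoset.len (toMinus p) (toMinus p) = 0 :=
        (MinusPoset.edgeLabelling hK).len_self _
      rw [h.2.2, h1, if_pos ⟨h.1, h.2.1⟩, zero_add]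
    | succ l =>
      have h1 : MinusPoset.len (toMinus p) (toMinus u) = 4 :=
        (MinusPoset.edgeLabelling hK).len_step h.2.2
      have h2 := h.2.1
      rw [h1, if_neg (by omega), add_zero]
  improve {a b c l l'} h h' hl := by
    obtain ⟨l, rfl⟩ : ∃ k, l = k + 1 := ⟨l - 1, by omega⟩
    have hca := h'.le.trans h.le
    cases l' with
    | zero =>
      -- A change of copy in second place can be made first: as the lower end contains `ρ`, so does
      -- `a`.
      obtain ⟨hk, hab⟩ := le_iff.1 h.1
      have hka : kind a = 0 := by
        have := h'.1
        omega
      obtain ⟨u, h1, h2, h3⟩ := exists_prime hka h'.2.1 (le_iff.1 hca).2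
      exact ⟨u, 0, ⟨hka, h1, h2⟩, h3, hl⟩
    | succ l' =>
      obtain ⟨u, m, hu, hcu, hm⟩ :=
        (MinusPoset.edgeLabelling hK).improve h.2.2 h'.2.2 (by omega : l' < l)
      obtain ⟨v, rfl, h1, h2, h3⟩ :=
        exists_lift hca hcu ((MinusPoset.edgeLabelling hK).step_lt hu).le
      exact ⟨v, m + 1, ⟨h2, h3, hu⟩, h1, by omega⟩
  descend {p q z w l m} h h' hqz hqw hl := by
    obtain ⟨l, rfl⟩ : ∃ k, l = k + 1 := ⟨l - 1, by omega⟩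
    obtain ⟨hkz, hqz'⟩ := le_iff.1 hqz
    obtain ⟨hkw, hqw'⟩ := le_iff.1 hqw
    cases m with
    | zero =>
      have h1 := h'.1
      have h2 := h'.2.1
      have h3 := h.2.1
      -- The change of copy through `w` remains possible after `z`, since `q` lies in the second
      -- copy.
      have hz : kind z = 0 := by omega
      obtain ⟨u, h4, h5, h6⟩ := exists_prime hz (by omega) hqz'
      exact ⟨u, 0, ⟨hz, h4, h5⟩, h6, hl⟩
    | succ m =>
      obtain ⟨u, k, hu, hqu, hk⟩ :=
        (MinusPoset.edgeLabelling hK).descend h.2.2 h'.2.2 hqz' hqw' (by omega : m < l)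
      obtain ⟨v, rfl, h1, h2, h3⟩ :=
        exists_lift hqz hqu ((MinusPoset.edgeLabelling hK).step_lt hu).le
      exact ⟨v, k + 1, ⟨h2, h3, hu⟩, h1, by omega⟩
  step_inj {p w z l} h h' := by
    cases l with
    | zero => exact eq_of_kind_eq (h.2.1.trans h'.2.1.symm) (h.2.2.trans h'.2.2.symm)
    | succ l =>
      have heq : toMinus w = toMinus z :=
        (MinusPoset.edgeLabelling hK).step_inj h.2.2 h'.2.2
      refine eq_of_kind_eq ?_ heq
      have h1 := kind_eq_one_iff w
      rw [heq, ← kind_eq_one_iff] at h1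
      have h2 := h.2.1
      have h3 := h'.2.1
      omega

end HatPoset

end StabilizationDiagram

theorem mainTheorem8 {N : ℕ} (S : StabilizationDiagram N) (hK : S.G.IsKnot) :
    (∀ y x : S.HatPoset, PosetShellable (Set.Icc y x)) ∧
      (∀ y x : S.MinusPoset, PosetShellable (Set.Icc y x)) :=
  ⟨(StabilizationDiagram.HatPoset.edgeLabelling hK).posetShellable_icc,
    (StabilizationDiagram.MinusPoset.edgeLabelling hK).posetShellable_icc⟩
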